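/- For $n\ge 2$ let $N_n$ be the group of real upper triangular $n\times n$ matrices with unit diagonal, and let $N_n^+\subset N_n$ be the set of those $M\in N_n$ all of whose minors that do not vanish identically on $N_n$ are positive. Let $P$ be the $n\times n$ matrix with $P_{ij}=\delta_{i+j,n+1}$. For every $M\in N_n^+$ there are unique $M',M''\in N_n^+$ and a unique diagonal matrix $D_M$ such that $$PMP=M'\,P\,D_M\,M''.$$ For $I,J\subset\{1,\dots,n\}$ let $\Delta_I(M)$ be the minor of $M$ with rows $I$ and the last $|I|$ columns, and $\Delta^J(M)$ the minor with the first $|J|$ rows and columns $J$; $\Delta_\emptyset=\Delta^\emptyset=1$. Write $[a,b]=\{i\in\mathbb{N}: a\le i\le b\}$. For $1\le a<b<c\le n$ put (all minors taken of $M$) $$Y_{abc}=\frac{\Delta_{[a,b-1]\cup[c+1,n]}\,\Delta_{[a+1,b]\cup[c,n]}}{\Delta_{[a,b]\cup[c+1,n]}\,\Delta_{[a+1,b-1]\cup[c,n]}},\qquad \tilde Y_{abc}=\frac{\Delta_{[1,a]\cup[b+1,c-1]}\,\Delta_{[1,a-1]\cup[b,c]}}{\Delta_{[1,a]\cup[b,c-1]}\,\Delta_{[1,a-1]\cup[b+1,c]}},$$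 $$Y^{abc}=\frac{\Delta^{[a,b]\cup[c+1,n]}\,\Delta^{[a+1,b-1]\cup[c,n]}}{\Delta^{[a,b-1]\cup[c+1,n]}\,\Delta^{[a+1,b]\cup[c,n]}},\qquad \tilde Y^{abc}=\frac{\Delta^{[1,a]\cup[b,c-1]}\,\Delta^{[1,a-1]\cup[b+1,c]}}{\Delta^{[1,a]\cup[b+1,c-1]}\,\Delta^{[1,a-1]\cup[b,c]}}.$$ Let $l(x)=\frac{6}{\pi^2}L\bigl(\frac{x}{1+x}\bigr)$ for $x>0$, where $L(x)=\mathrm{Li}_2(x)+\frac12\log x\,\log(1-x)$ and $\mathrm{Li}_2(x)=\sum_{k\ge1}x^k/k^2$ for $0<x<1$, and let $T_n=\{(a,b,c)\in\mathbb{N}^3: 1\le a<b<c\le n\}$. Theorem. For every $M\in N_n^+$, $$\begin{aligned} &\sum_{T_n} l\bigl(Y_{abc}(M')\bigr)=\sum_{T_n} l\Bigl(\frac1{Y_{abc}(M)}\Bigr)=\sum_{T_n} l\bigl(Y_{abc}(M'')\bigr)\\ =&\sum_{T_n} l\bigl(\tilde Y^{abc}(M')\bigr)=\sum_{T_n} l\Bigl(\frac1{\tilde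 Y^{abc}(M)}\Bigr)=\sum_{T_n} l\bigl(\tilde Y^{abc}(M'')\bigr)\\ =&\sum_{T_n} l\bigl(\tilde Y_{abc}(M')\bigr)=\sum_{T_n} l\Bigl(\frac1{\tilde Y_{abc}(M)}\Bigr)=\sum_{T_n} l\bigl(\tilde Y_{abc}(M'')\bigr)\\ =&\sum_{T_n} l\bigl(Y^{abc}(M')\bigr)=\sum_{T_n} l\Bigl(\frac1{Y^{abc}(M)}\Bigr)=\sum_{T_n} l\bigl(Y^{abc}(M'')\bigr), \end{aligned}$$ where each sum runs over all $(a,b,c)\in T_n$. -/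

import Mathlib

/-- The dilogarithm `Li₂(x) = ∑_{k ≥ 1} x ^ k / k ^ 2`; the series converges for `|x| ≤ 1`. -/
noncomputable def dilog (x : ℝ) : ℝ := ∑' k : ℕ, x ^ (k + 1) / ((k : ℝ) + 1) ^ 2

/-- The Rogers dilogarithm, meaningful for `0 < x < 1`. -/
noncomputable def rogersL (x : ℝ) : ℝ := dilog x + 1 / 2 * Real.log x * Real.log (1 - x)

/-- The rescaled Rogers dilogarithm `l`, meaningful for `0 < x`. -/
noncomputable def rogersl (x : ℝ) : ℝ := 6 / Real.pi ^ 2 * rogersL (x / (1 + x))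

/-- Membership in `N_n`: upper triangular with unit diagonal. -/
def IsUpperUnitriangular {n : ℕ} (M : Matrix (Fin n) (Fin n) ℝ) : Prop :=
  (∀ i j, j < i → M i j = 0) ∧ ∀ i, M i i = 1

/-- Membership in `N_n⁺`: every minor that does not vanish identically on `N_n` is positive.
A minor is given by increasing lists `I` of rows and `J` of columns of the same length. -/
def IsTotallyPositiveUnitriangular {n : ℕ} (M : Matrix (Fin n) (Fin n) ℝ) : Prop :=
  IsUpperUnitriangular M ∧
    ∀ (k : ℕ) (I J : Fin k ↪o Fin n),
      (∃ H : Matrix (Fin n) (Fin n) ℝ, IsUpperUnitriangular H ∧ (H.submatrix I J).det ≠ 0) →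
        0 < (M.submatrix I J).det

/-- The permutation matrix of `w₀`: ones on the antidiagonal. -/
def antidiagonalMatrix (n : ℕ) : Matrix (Fin n) (Fin n) ℝ :=
  Matrix.of fun i j => if (i : ℕ) + (j : ℕ) + 1 = n then 1 else 0

/-- `M' = A`, `M'' = B` and `D_M = diagonal d`: both `A` and `B` lie in `N_n⁺` and
`P M P = A P D B`. -/
def IsGaussTriple {n : ℕ} (M A B : Matrix (Fin n) (Fin n) ℝ) (d : Fin n → ℝ) : Prop :=
  IsTotallyPositiveUnitriangular A ∧ IsTotallyPositiveUnitriangular B ∧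
    antidiagonalMatrix n * M * antidiagonalMatrix n =
      A * antidiagonalMatrix n * Matrix.diagonal d * B

/-- The subset of `Fin n` that a set `I ⊆ {1, …, n}` of one-based labels stands for. -/
def labelSet (n : ℕ) (I : Finset ℕ) : Finset (Fin n) :=
  Finset.univ.filter fun i => (i : ℕ) + 1 ∈ I

theorem labelSet_card_le (n : ℕ) (I : Finset ℕ) : (labelSet n I).card ≤ n := by
  simpa using Finset.card_le_univ (labelSet n I)

/-- The right flag minor `Δ_I`: rows labelled by `I ⊆ {1, …, n}`, last `|I|` columns. -/
def rightFlagMinor {n : ℕ} (M : Matrix (Fin n) (Fin n) ℝ) (I : Finset ℕ) : ℝ :=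
  (M.submatrix ((labelSet n I).orderEmbOfFin rfl)
    (fun k : Fin (labelSet n I).card =>
      (⟨n - (labelSet n I).card + k, by
        have h1 := labelSet_card_le n I
        have h2 := k.isLt
        omega⟩ : Fin n))).det

/-- The upper flag minor `Δ^J`: first `|J|` rows, columns labelled by `J ⊆ {1, …, n}`. -/
def upperFlagMinor {n : ℕ} (M : Matrix (Fin n) (Fin n) ℝ) (J : Finset ℕ) : ℝ :=
  (M.submatrix (Fin.castLE (labelSet_card_le n J)) ((labelSet n J).orderEmbOfFin rfl)).det

/-- `Y_{abc}`. -/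
noncomputable def lowerY {n : ℕ} (M : Matrix (Fin n) (Fin n) ℝ) (a b c : ℕ) : ℝ :=
  (rightFlagMinor M (Finset.Icc a (b - 1) ∪ Finset.Icc (c + 1) n) *
      rightFlagMinor M (Finset.Icc (a + 1) b ∪ Finset.Icc c n)) /
    (rightFlagMinor M (Finset.Icc a b ∪ Finset.Icc (c + 1) n) *
      rightFlagMinor M (Finset.Icc (a + 1) (b - 1) ∪ Finset.Icc c n))

/-- `Ỹ_{abc}`. -/
noncomputable def lowerYTilde {n : ℕ} (M : Matrix (Fin n) (Fin n) ℝ) (a b c : ℕ) : ℝ :=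
  (rightFlagMinor M (Finset.Icc 1 a ∪ Finset.Icc (b + 1) (c - 1)) *
      rightFlagMinor M (Finset.Icc 1 (a - 1) ∪ Finset.Icc b c)) /
    (rightFlagMinor M (Finset.Icc 1 a ∪ Finset.Icc b (c - 1)) *
      rightFlagMinor M (Finset.Icc 1 (a - 1) ∪ Finset.Icc (b + 1) c))

/-- `Y^{abc}`. -/
noncomputable def upperY {n : ℕ} (M : Matrix (Fin n) (Fin n) ℝ) (a b c : ℕ) : ℝ :=
  (upperFlagMinor M (Finset.Icc a b ∪ Finset.Icc (c + 1) n) *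
      upperFlagMinor M (Finset.Icc (a + 1) (b - 1) ∪ Finset.Icc c n)) /
    (upperFlagMinor M (Finset.Icc a (b - 1) ∪ Finset.Icc (c + 1) n) *
      upperFlagMinor M (Finset.Icc (a + 1) b ∪ Finset.Icc c n))

/-- `Ỹ^{abc}`. -/
noncomputable def upperYTilde {n : ℕ} (M : Matrix (Fin n) (Fin n) ℝ) (a b c : ℕ) : ℝ :=
  (upperFlagMinor M (Finset.Icc 1 a ∪ Finset.Icc b (c - 1)) *
      upperFlagMinor M (Finset.Icc 1 (a - 1) ∪ Finset.Icc (b + 1) c)) /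
    (upperFlagMinor M (Finset.Icc 1 a ∪ Finset.Icc (b + 1) (c - 1)) *
      upperFlagMinor M (Finset.Icc 1 (a - 1) ∪ Finset.Icc b c))

/-- The discrete tetrahedron `T_n`: triples `1 ≤ a < b < c ≤ n`. -/
def tetrahedron (n : ℕ) : Finset (ℕ × ℕ × ℕ) :=
  (Finset.Icc 1 n ×ˢ Finset.Icc 1 n ×ˢ Finset.Icc 1 n).filter
    fun t => t.1 < t.2.1 ∧ t.2.1 < t.2.2

/-- `∑_{(a,b,c) ∈ T_n} l(Y a b c)`. -/
noncomputable def dilogSum (n : ℕ) (Y : ℕ → ℕ → ℕ → ℝ) : ℝ :=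
  ∑ t ∈ tetrahedron n, rogersl (Y t.1 t.2.1 t.2.2)

open Finset Matrix

/-!
The right flag minors `Δ_I` of a totally positive matrix are positive and satisfy the three-term
Plücker relations. The exchange ratio of a triple `a < b < c` depends on a context, the set of the
other labels present; for each packet of four labels, reversing the packet changes the contexts of
its four triples, and two instances of the five-term relation of the Rogers dilogarithm show that
the sum of `l` over these triples does not change. The contexts of the `Y_{abc}` become those of
the `Ỹ_{abc}` when all packets are reversed, so the two families have the same sum.

The other equalities are termwise. Comparing flag minors in `P M P = M' P D M''` gives
`Δ_I(M') = Δ_{w₀ I}(M) / Δ_{[1, |I|]}(M)`, which turns exchange ratios of `M'` into inverse exchange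
ratios of `M`. Reflection in the antidiagonal exchanges right and upper flag minors and the roles of
`M'` and `M''`, and the minors with consecutive rows and consecutive columns, of which `Y_{abc}` and
`Ỹ^{abc}` are ratios, belong to both families. The formula for `Δ_I(M')` also makes the flag minors
of `M'` positive, and by a criterion of Fekete type this already implies `M' ∈ N_n⁺`.
-/

/-! ### The Rogers dilogarithm -/

theorem hasDerivAt_dilog {x : ℝ} (hx : |x| < 1) :
    HasDerivAt dilog (∑' k : ℕ, x ^ k / ((k : ℝ) + 1)) x := by
  obtain ⟨r, hxr, hr⟩ := exists_between hx
  have hr0 : 0 < r := (abs_nonneg x).trans_lt hxr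
  refine hasDerivAt_tsum_of_isPreconnected (u := fun k : ℕ ↦ r ^ k) (t := Metric.ball 0 r) (y₀ := 0)
    (g := fun k z ↦ z ^ (k + 1) / ((k : ℝ) + 1) ^ 2) (g' := fun k z ↦ z ^ k / ((k : ℝ) + 1))
    (summable_geometric_of_lt_one hr0.le hr) Metric.isOpen_ball (convex_ball _ _).isPreconnected
    (fun k z _ ↦ ?_) (fun k z hz ↦ ?_) (Metric.mem_ball_self hr0) (by simp) (by simpa using hxr)
  · refine ((hasDerivAt_pow (k + 1) z).div_const (((k : ℝ) + 1) ^ 2)).congr_deriv ?_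
    push_cast
    field_simp
  · rw [mem_ball_zero_iff] at hz
    have hk : (0 : ℝ) ≤ k + 1 := by positivity
    rw [norm_div, norm_pow, Real.norm_of_nonneg hk]
    exact (div_le_self (by positivity) (by simp)).trans (by gcongr)

theorem hasDerivAt_rogersL {x : ℝ} (h0 : 0 < x) (h1 : x < 1) :
    HasDerivAt rogersL (-(1 / 2) * (Real.log (1 - x) / x + Real.log x / (1 - x))) x := by
  have h1' : 1 - x ≠ 0 := by linarith
  have habs : |x| < 1 := abs_lt.2 ⟨by linarith, h1⟩
  have hseries : ∑' k : ℕ, x ^ k / ((k : ℝ) + 1) = -Real.log (1 - x) / x := by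
    refine HasSum.tsum_eq (((Real.hasSum_pow_div_log_of_abs_lt_one habs).div_const x).congr_fun
      fun k ↦ ?_)
    rw [pow_succ]
    field_simp
  have hlog : HasDerivAt (fun y ↦ Real.log (1 - y)) (-1 / (1 - x)) x :=
    ((hasDerivAt_id x).const_sub 1).log h1'
  refine ((hasDerivAt_dilog habs).add
    (((Real.hasDerivAt_log h0.ne').const_mul (1 / 2)).mul hlog)).congr_deriv ?_
  rw [hseries]
  field_simp
  ring

theorem rogersL_zero : rogersL 0 = 0 := by
  simp [rogersL, dilog]

theorem continuousAt_rogersL {x : ℝ} (h0 : 0 ≤ x) (h1 : x < 1) : ContinuousAt rogersL x := by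
  rcases h0.eq_or_lt with rfl | h0
  · -- `log x * log (1 - x)` is `x log x` times a difference quotient of `log (1 - x)` at `0`.
    have hlog : DifferentiableAt ℝ (fun x : ℝ ↦ Real.log (1 - x)) 0 := by
      fun_prop (disch := norm_num)
    have hmul : ∀ x : ℝ, Real.log x * Real.log (1 - x) =
        x * Real.log x * dslope (fun x ↦ Real.log (1 - x)) 0 x := by
      intro x
      rcases eq_or_ne x 0 with rfl | hx
      · simp
      · rw [dslope_of_ne _ hx, slope_def_field]
        simp
        field_simp
    have hprod : ContinuousAt (fun x : ℝ ↦ Real.log x * Real.log (1 - x)) 0 := by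
      simp only [hmul]
      exact Real.continuous_mul_log.continuousAt.mul (continuousAt_dslope_same.2 hlog)
    have hdilog := (hasDerivAt_dilog (x := 0) (by simp)).continuousAt
    refine (hdilog.add (hprod.const_mul (1 / 2))).congr (.of_forall fun x ↦ ?_)
    simp only [Pi.add_apply, rogersL, mul_assoc]
  · exact (hasDerivAt_rogersL h0 h1).continuousAt

/-- The difference of the two sides of the five-term relation of the Rogers dilogarithm, to be
shown constant in `x`. -/
noncomputable def fiveTermDefect (y x : ℝ) : ℝ :=
  rogersL x + rogersL y - (rogersL (x * y) + rogersL (x * (1 - y) / (1 - x * y)) +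
    rogersL (y * (1 - x) / (1 - x * y)))

section FiveTerm

variable {x y : ℝ}

theorem one_sub_five_term_left (h : x * y < 1) :
    1 - x * (1 - y) / (1 - x * y) = (1 - x) / (1 - x * y) := by
  have : 1 - x * y ≠ 0 := by linarith
  field_simp
  ring

theorem five_term_args_mem_Ico (hx0 : 0 ≤ x) (hx1 : x < 1) (hy0 : 0 < y) (hy1 : y < 1) :
    x * y ∈ Set.Ico 0 1 ∧ x * (1 - y) / (1 - x * y) ∈ Set.Ico 0 1 ∧
      y * (1 - x) / (1 - x * y) ∈ Set.Ico 0 1 := by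
  have hxy : x * y < 1 := mul_lt_one_of_nonneg_of_lt_one_left hx0 hx1 hy1.le
  have hx1' : 0 < 1 - x := by linarith
  have hy1' : 0 < 1 - y := by linarith
  have hxy' : 0 < 1 - x * y := by linarith
  refine ⟨⟨mul_nonneg hx0 hy0.le, hxy⟩, ⟨div_nonneg (mul_nonneg hx0 hy1'.le) hxy'.le, ?_⟩,
    ⟨div_nonneg (mul_nonneg hy0.le hx1'.le) hxy'.le, ?_⟩⟩
  all_goals
    rw [div_lt_one hxy']
    linarith

theorem hasDerivAt_fiveTermDefect (hx0 : 0 < x) (hx1 : x < 1) (hy0 : 0 < y) (hy1 : y < 1) :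
    HasDerivAt (fiveTermDefect y) 0 x := by
  obtain ⟨⟨-, hu⟩, ⟨-, hv⟩, ⟨-, hw⟩⟩ := five_term_args_mem_Ico hx0.le hx1 hy0 hy1
  have hx1' : 0 < 1 - x := by linarith
  have hy1' : 0 < 1 - y := by linarith
  have hxy' : 0 < 1 - x * y := by linarith
  have hv1 := one_sub_five_term_left hu
  have hw1 : 1 - y * (1 - x) / (1 - x * y) = (1 - y) / (1 - x * y) := by
    rw [mul_comm x y] at hu ⊢
    exact one_sub_five_term_left hu
  have hdu : HasDerivAt (fun x ↦ x * y) y x := by simpa using (hasDerivAt_id x).mul_const y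
  have hdC : HasDerivAt (fun x ↦ 1 - x * y) (-y) x := hdu.const_sub 1
  have hdv : HasDerivAt (fun x ↦ x * (1 - y) / (1 - x * y)) ((1 - y) / (1 - x * y) ^ 2) x := by
    refine (((hasDerivAt_id x).mul_const (1 - y)).div hdC hxy'.ne').congr_deriv ?_
    simp only [id]
    ring
  have hdw : HasDerivAt (fun x ↦ y * (1 - x) / (1 - x * y))
      (-(y * (1 - y)) / (1 - x * y) ^ 2) x := by
    refine ((((hasDerivAt_id x).const_sub 1).const_mul y).div hdC hxy'.ne').congr_deriv ?_
    simp only [id]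
    ring
  have hLu := (hasDerivAt_rogersL (mul_pos hx0 hy0) hu).comp x hdu
  have hLv := (hasDerivAt_rogersL (by positivity) hv).comp x hdv
  have hLw := (hasDerivAt_rogersL (by positivity) hw).comp x hdw
  refine (((hasDerivAt_rogersL hx0 hx1).add_const (rogersL y)).sub
    ((hLu.add hLv).add hLw)).congr_deriv ?_
  rw [hv1, hw1, Real.log_div hx1'.ne' hxy'.ne', Real.log_div hy1'.ne' hxy'.ne',
    Real.log_div (by positivity) hxy'.ne', Real.log_div (by positivity) hxy'.ne',
    Real.log_mul hx0.ne' hy1'.ne', Real.log_mul hy0.ne' hx1'.ne', Real.log_mul hx0.ne' hy0.ne']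
  have := hx1'.ne'
  have := hy1'.ne'
  have := hxy'.ne'
  field_simp
  ring

theorem continuousAt_fiveTermDefect (hx0 : 0 ≤ x) (hx1 : x < 1) (hy0 : 0 < y) (hy1 : y < 1) :
    ContinuousAt (fiveTermDefect y) x := by
  obtain ⟨hu, hv, hw⟩ := five_term_args_mem_Ico hx0 hx1 hy0 hy1
  have hxy : 1 - x * y ≠ 0 := by linarith [hu.2]
  have hLu : ContinuousAt (fun x ↦ rogersL (x * y)) x :=
    (continuousAt_rogersL hu.1 hu.2).comp (f := fun x ↦ x * y) (by fun_prop)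
  have hLv : ContinuousAt (fun x ↦ rogersL (x * (1 - y) / (1 - x * y))) x :=
    (continuousAt_rogersL hv.1 hv.2).comp (f := fun x ↦ x * (1 - y) / (1 - x * y))
      (by fun_prop (disch := assumption))
  have hLw : ContinuousAt (fun x ↦ rogersL (y * (1 - x) / (1 - x * y))) x :=
    (continuousAt_rogersL hw.1 hw.2).comp (f := fun x ↦ y * (1 - x) / (1 - x * y))
      (by fun_prop (disch := assumption))
  exact ((continuousAt_rogersL hx0 hx1).add continuousAt_const).sub ((hLu.add hLv).add hLw)

theorem rogersL_five_term (hx0 : 0 < x) (hx1 : x < 1) (hy0 : 0 < y) (hy1 : y < 1) :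
    rogersL x + rogersL y = rogersL (x * y) + rogersL (x * (1 - y) / (1 - x * y)) +
      rogersL (y * (1 - x) / (1 - x * y)) := by
  have hcont : ContinuousOn (fiveTermDefect y) (Set.Icc 0 x) := fun t ht ↦
    (continuousAt_fiveTermDefect ht.1 (ht.2.trans_lt hx1) hy0 hy1).continuousWithinAt
  obtain ⟨t, -, hslope⟩ := exists_hasDerivAt_eq_slope (fiveTermDefect y) (fun _ ↦ 0) hx0 hcont
    fun t ht ↦ hasDerivAt_fiveTermDefect ht.1 (ht.2.trans hx1) hy0 hy1
  have hconst : fiveTermDefect y x = fiveTermDefect y 0 := by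
    rw [eq_comm, div_eq_zero_iff] at hslope
    exact sub_eq_zero.1 (hslope.resolve_right (by linarith))
  have hzero : fiveTermDefect y 0 = 0 := by simp [fiveTermDefect, rogersL_zero]
  exact sub_eq_zero.1 (hconst.trans hzero)

end FiveTerm

/-! ### Positive solutions of the three-term relations -/

/-- The ratio `f(Xa) f(Xbc) / (f(Xab) f(Xc))`: the exchange of the triple `a < b < c` in the
context `X`. The functions `Y` and `Ỹ` are such ratios. -/
noncomputable def exchangeRatio (f : Finset ℕ → ℝ) (X : Finset ℕ) (a b c : ℕ) : ℝ :=
  (f (insert a X) * f (insert b (insert c X))) / (f (insert a (insert b X)) * f (insert c X))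

/-- Positive solutions of the three-term Plücker relations among labels in `{1, …, n}`, the
relations satisfied by the flag minors of a matrix of size `n`. -/
structure IsPositiveFlag (n : ℕ) (f : Finset ℕ → ℝ) : Prop where
  pos : ∀ I, 0 < f I
  three_term : ∀ {X : Finset ℕ} {a b c : ℕ}, 1 ≤ a → a < b → b < c → c ≤ n →
    a ∉ X → b ∉ X → c ∉ X →
    f (insert b X) * f (insert a (insert c X)) =
      f (insert a (insert b X)) * f (insert c X) + f (insert a X) * f (insert b (insert c X))

theorem rogersl_div {p q r : ℝ} (hq : 0 < q) (hr : 0 < r) (h : r = q + p) :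
    rogersl (p / q) = 6 / Real.pi ^ 2 * rogersL (p / r) := by
  subst h
  rw [rogersl]
  congr 2
  field_simp

theorem rogersL_five_term_of_three_term {f1 f2 f3 f4 f12 f13 f14 f23 f24 f34 : ℝ}
    (h1 : 0 < f1) (h2 : 0 < f2) (h3 : 0 < f3) (h4 : 0 < f4) (h12 : 0 < f12) (h13 : 0 < f13)
    (h14 : 0 < f14) (h23 : 0 < f23) (h24 : 0 < f24) (h34 : 0 < f34)
    (e124 : f2 * f14 = f12 * f4 + f1 * f24) (e134 : f3 * f14 = f13 * f4 + f1 * f34)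
    (e234 : f3 * f24 = f23 * f4 + f2 * f34) :
    rogersL (f1 * f24 / (f2 * f14)) + rogersL (f2 * f34 / (f3 * f24)) =
      rogersL (f1 * f34 / (f3 * f14)) + rogersL (f1 * f23 / (f2 * f13)) +
        rogersL (f12 * f34 / (f13 * f24)) := by
  have one_sub : ∀ {p q r : ℝ}, 0 < q → q = r + p → 1 - p / q = r / q := fun hq h ↦ by
    rw [one_sub_div hq.ne', h, add_sub_cancel_right]
  have lt_one : ∀ {p q r : ℝ}, 0 < q → 0 < r → q = r + p → p / q < 1 := fun hq hr h ↦ by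
    rw [div_lt_one hq]
    linarith
  have hxy : f1 * f24 / (f2 * f14) * (f2 * f34 / (f3 * f24)) = f1 * f34 / (f3 * f14) := by
    field_simp
  rw [rogersL_five_term (by positivity) (lt_one (by positivity) (by positivity) e124)
    (by positivity) (lt_one (by positivity) (by positivity) e234), hxy,
    one_sub (by positivity) e124, one_sub (by positivity) e134, one_sub (by positivity) e234]
  congr 2
  · congr 1
    field_simp
  · field_simp

namespace IsPositiveFlag

variable {n : ℕ} {f : Finset ℕ → ℝ} {Z : Finset ℕ} {p q r s : ℕ}

theorem rogersl_exchangeRatio (hf : IsPositiveFlag n f) {a b c : ℕ} (ha : 1 ≤ a) (hab : a < b)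
    (hbc : b < c) (hc : c ≤ n) (haZ : a ∉ Z) (hbZ : b ∉ Z) (hcZ : c ∉ Z) :
    rogersl (exchangeRatio f Z a b c) = 6 / Real.pi ^ 2 *
      rogersL (f (insert a Z) * f (insert b (insert c Z)) /
        (f (insert b Z) * f (insert a (insert c Z)))) :=
  rogersl_div (mul_pos (hf.pos _) (hf.pos _)) (mul_pos (hf.pos _) (hf.pos _))
    (hf.three_term ha hab hbc hc haZ hbZ hcZ)

theorem rogersl_five_term (hf : IsPositiveFlag n f) (hp : 1 ≤ p) (hpq : p < q) (hqr : q < r)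
    (hrs : r < s) (hs : s ≤ n) (hpZ : p ∉ Z) (hqZ : q ∉ Z) (hrZ : r ∉ Z) (hsZ : s ∉ Z) :
    rogersl (exchangeRatio f Z p q s) + rogersl (exchangeRatio f Z q r s) =
      rogersl (exchangeRatio f Z p r s) + rogersl (exchangeRatio f Z p q r) +
        6 / Real.pi ^ 2 * rogersL (f (insert p (insert q Z)) * f (insert r (insert s Z)) /
          (f (insert p (insert r Z)) * f (insert q (insert s Z)))) := by
  have hpr := hpq.trans hqr
  have hqs := hqr.trans hrs
  have hq := hp.trans hpq.le
  rw [hf.rogersl_exchangeRatio hp hpq hqs hs hpZ hqZ hsZ,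
    hf.rogersl_exchangeRatio hq hqr hrs hs hqZ hrZ hsZ,
    hf.rogersl_exchangeRatio hp hpr hrs hs hpZ hrZ hsZ,
    hf.rogersl_exchangeRatio hp hpq hqr (hrs.le.trans hs) hpZ hqZ hrZ, ← mul_add, ← mul_add,
    ← mul_add]
  congr 1
  exact rogersL_five_term_of_three_term (hf.pos _) (hf.pos _) (hf.pos _) (hf.pos _) (hf.pos _)
    (hf.pos _) (hf.pos _) (hf.pos _) (hf.pos _) (hf.pos _)
    (hf.three_term hp hpq hqs hs hpZ hqZ hsZ) (hf.three_term hp hpr hrs hs hpZ hrZ hsZ)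
    (hf.three_term hq hqr hrs hs hqZ hrZ hsZ)

-- The previous relation for the function `I ↦ f (Z ∪ ({p, q, r, s} \ I))`.
theorem rogersl_five_term_compl (hf : IsPositiveFlag n f) (hp : 1 ≤ p) (hpq : p < q) (hqr : q < r)
    (hrs : r < s) (hs : s ≤ n) (hpZ : p ∉ Z) (hqZ : q ∉ Z) (hrZ : r ∉ Z) (hsZ : s ∉ Z) :
    rogersl (exchangeRatio f (insert r Z) p q s) + rogersl (exchangeRatio f (insert p Z) q r s) =
      rogersl (exchangeRatio f (insert q Z) p r s) + rogersl (exchangeRatio f (insert s Z) p q r) +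
        6 / Real.pi ^ 2 * rogersL (f (insert p (insert q Z)) * f (insert r (insert s Z)) /
          (f (insert p (insert r Z)) * f (insert q (insert s Z)))) := by
  have notMem : ∀ {x y : ℕ}, x ≠ y → x ∉ Z → x ∉ insert y Z := fun hxy hx ↦ by
    simp only [mem_insert, hxy, hx, or_self, not_false_eq_true]
  have hpr := hpq.trans hqr
  have hqs := hqr.trans hrs
  have hps := hpr.trans hrs
  have hq := hp.trans hpq.le
  have hrn := hrs.le.trans hs
  have e₁ := hf.three_term hp hpq hqs hs (notMem hpr.ne hpZ) (notMem hqr.ne hqZ)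
    (notMem hrs.ne' hsZ)
  have e₂ := hf.three_term hp hpr hrs hs (notMem hpq.ne hpZ) (notMem hqr.ne' hrZ)
    (notMem hqs.ne' hsZ)
  have e₃ := hf.three_term hq hqr hrs hs (notMem hpq.ne' hqZ) (notMem hpr.ne' hrZ)
    (notMem hps.ne' hsZ)
  rw [hf.rogersl_exchangeRatio hp hpq hqs hs (notMem hpr.ne hpZ) (notMem hqr.ne hqZ)
      (notMem hrs.ne' hsZ),
    hf.rogersl_exchangeRatio hq hqr hrs hs (notMem hpq.ne' hqZ) (notMem hpr.ne' hrZ)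
      (notMem hps.ne' hsZ),
    hf.rogersl_exchangeRatio hp hpr hrs hs (notMem hpq.ne hpZ) (notMem hqr.ne' hrZ)
      (notMem hqs.ne' hsZ),
    hf.rogersl_exchangeRatio hp hpq hqr hrn (notMem hps.ne hpZ) (notMem hqs.ne hqZ)
      (notMem hrs.ne hrZ), ← mul_add, ← mul_add, ← mul_add]
  congr 1
  simp only [insert_comm q p, insert_comm r p, insert_comm s p, insert_comm r q, insert_comm s q,
    insert_comm s r] at e₁ e₂ e₃ ⊢
  have five_term := rogersL_five_term_of_three_term (hf.pos (insert q (insert r (insert s Z))))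
    (hf.pos (insert p (insert r (insert s Z)))) (hf.pos (insert p (insert q (insert s Z))))
    (hf.pos (insert p (insert q (insert r Z)))) (hf.pos (insert r (insert s Z)))
    (hf.pos (insert q (insert s Z))) (hf.pos (insert q (insert r Z)))
    (hf.pos (insert p (insert s Z))) (hf.pos (insert p (insert r Z)))
    (hf.pos (insert p (insert q Z))) (by linarith) (by linarith) (by linarith)
  convert five_term using 4 <;> ring

theorem rogersl_four_term (hf : IsPositiveFlag n f) (hp : 1 ≤ p) (hpq : p < q) (hqr : q < r)
    (hrs : r < s) (hs : s ≤ n) (hpZ : p ∉ Z) (hqZ : q ∉ Z) (hrZ : r ∉ Z) (hsZ : s ∉ Z) :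
    rogersl (exchangeRatio f (insert s Z) p q r) + rogersl (exchangeRatio f Z p q s) +
      rogersl (exchangeRatio f (insert q Z) p r s) + rogersl (exchangeRatio f Z q r s) =
    rogersl (exchangeRatio f Z p q r) + rogersl (exchangeRatio f (insert r Z) p q s) +
      rogersl (exchangeRatio f Z p r s) + rogersl (exchangeRatio f (insert p Z) q r s) := by
  have h := hf.rogersl_five_term hp hpq hqr hrs hs hpZ hqZ hrZ hsZ
  have h' := hf.rogersl_five_term_compl hp hpq hqr hrs hs hpZ hqZ hrZ hsZ
  linarith

end IsPositiveFlag

/-! ### Reversing packets -/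

/-- The context in which the triple `a < b < c` is exchanged once the packets `{a, b, c, d}` with
`d ≤ m` have been reversed. -/
def exchangeContext (n m a b c : ℕ) : Finset ℕ :=
  {d ∈ Icc 1 n | (d ≤ m ∧ (d < a ∨ b < d ∧ d < c)) ∨ (m < d ∧ (a < d ∧ d < b ∨ c < d))}

/-- The set of packets: quadruples `1 ≤ p < q < r < s ≤ n`. -/
def quadruples (n : ℕ) : Finset (ℕ × ℕ × ℕ × ℕ) :=
  {x ∈ Icc 1 n ×ˢ Icc 1 n ×ˢ Icc 1 n ×ˢ Icc 1 n |
    x.1 < x.2.1 ∧ x.2.1 < x.2.2.1 ∧ x.2.2.1 < x.2.2.2}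

theorem mem_tetrahedron {n : ℕ} {t : ℕ × ℕ × ℕ} :
    t ∈ tetrahedron n ↔ 1 ≤ t.1 ∧ t.1 < t.2.1 ∧ t.2.1 < t.2.2 ∧ t.2.2 ≤ n := by
  simp only [tetrahedron, mem_filter, mem_product, mem_Icc]
  omega

theorem mem_quadruples {n : ℕ} {x : ℕ × ℕ × ℕ × ℕ} :
    x ∈ quadruples n ↔
      1 ≤ x.1 ∧ x.1 < x.2.1 ∧ x.2.1 < x.2.2.1 ∧ x.2.2.1 < x.2.2.2 ∧ x.2.2.2 ≤ n := by
  simp only [quadruples, mem_filter, mem_product, mem_Icc]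
  omega

theorem sum_tetrahedron_sum_Icc {R : Type*} [AddCommMonoid R] {n : ℕ} {g : ℕ → ℕ → ℕ → ℕ → R}
    (hg : ∀ {a b c d}, a < b → b < c → (d = a ∨ d = b ∨ d = c) → g a b c d = 0) :
    ∑ t ∈ tetrahedron n, ∑ d ∈ Icc 1 n, g t.1 t.2.1 t.2.2 d =
      ∑ x ∈ quadruples n, (g x.2.1 x.2.2.1 x.2.2.2 x.1 + g x.1 x.2.2.1 x.2.2.2 x.2.1 +
        g x.1 x.2.1 x.2.2.2 x.2.2.1 + g x.1 x.2.1 x.2.2.1 x.2.2.2) := by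
  let G : (ℕ × ℕ × ℕ) × ℕ → R := fun x ↦ g x.1.1 x.1.2.1 x.1.2.2 x.2
  let S := tetrahedron n ×ˢ Icc 1 n
  have hsplit : ∀ x ∈ S, G x = (if x.2 < x.1.1 then G x else 0) +
      (if x.1.1 < x.2 ∧ x.2 < x.1.2.1 then G x else 0) +
      (if x.1.2.1 < x.2 ∧ x.2 < x.1.2.2 then G x else 0) + (if x.1.2.2 < x.2 then G x else 0) := by
    intro x hx
    simp only [S, mem_product, mem_tetrahedron] at hx
    by_cases hd : x.2 = x.1.1 ∨ x.2 = x.1.2.1 ∨ x.2 = x.1.2.2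
    · simp only [G, hg hx.1.2.1 hx.1.2.2.1 hd, ite_self, add_zero]
    · split_ifs <;> first | omega | simp only [add_zero, zero_add]
  rw [← sum_product' (tetrahedron n) (Icc 1 n) fun t d ↦ g t.1 t.2.1 t.2.2 d, sum_congr rfl hsplit]
  simp only [sum_add_distrib, ← sum_filter]
  congr 1
  · congr 1
    · congr 1
      · exact sum_nbij' (fun x ↦ (x.2, x.1.1, x.1.2.1, x.1.2.2))
          (fun x ↦ ((x.2.1, x.2.2.1, x.2.2.2), x.1)) (by grind [mem_quadruples, mem_tetrahedron])
          (by grind [mem_quadruples, mem_tetrahedron]) (by simp) (by simp) (by simp [G])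
      · exact sum_nbij' (fun x ↦ (x.1.1, x.2, x.1.2.1, x.1.2.2))
          (fun x ↦ ((x.1, x.2.2.1, x.2.2.2), x.2.1)) (by grind [mem_quadruples, mem_tetrahedron])
          (by grind [mem_quadruples, mem_tetrahedron]) (by simp) (by simp) (by simp [G])
    · exact sum_nbij' (fun x ↦ (x.1.1, x.1.2.1, x.2, x.1.2.2))
        (fun x ↦ ((x.1, x.2.1, x.2.2.2), x.2.2.1)) (by grind [mem_quadruples, mem_tetrahedron])
        (by grind [mem_quadruples, mem_tetrahedron]) (by simp) (by simp) (by simp [G])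
  · exact sum_nbij' (fun x ↦ (x.1.1, x.1.2.1, x.1.2.2, x.2))
      (fun x ↦ ((x.1, x.2.1, x.2.2.1), x.2.2.2)) (by grind [mem_quadruples, mem_tetrahedron])
      (by grind [mem_quadruples, mem_tetrahedron]) (by simp) (by simp) (by simp [G])

/-- The contribution of the triple `a < b < c` once the packets `{a, b, c, d}` with `d ≤ m` have
been reversed. -/
noncomputable def exchangeTerm (n : ℕ) (f : Finset ℕ → ℝ) (m a b c : ℕ) : ℝ :=
  rogersl (exchangeRatio f (exchangeContext n m a b c) a b c)

theorem exchangeContext_sub_one {n a b c d : ℕ} (hab : a < b) (hbc : b < c)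
    (hd : d = a ∨ d = b ∨ d = c) :
    exchangeContext n (d - 1) a b c = exchangeContext n d a b c := by
  ext x
  simp only [exchangeContext, mem_filter, mem_Icc]
  omega

theorem IsPositiveFlag.packet_sum_eq_zero {n : ℕ} {f : Finset ℕ → ℝ} (hf : IsPositiveFlag n f)
    {p q r s : ℕ} (hp : 1 ≤ p) (hpq : p < q) (hqr : q < r) (hrs : r < s) (hs : s ≤ n) :
    (exchangeTerm n f (p - 1) q r s - exchangeTerm n f p q r s) +
      (exchangeTerm n f (q - 1) p r s - exchangeTerm n f q p r s) +
      (exchangeTerm n f (r - 1) p q s - exchangeTerm n f r p q s) +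
      (exchangeTerm n f (s - 1) p q r - exchangeTerm n f s p q r) = 0 := by
  let Z : Finset ℕ := {d ∈ Icc 1 n | d < p ∨ (q < d ∧ d < r) ∨ s < d}
  have mem_Z : ∀ x, x ∈ Z ↔ (1 ≤ x ∧ x ≤ n) ∧ (x < p ∨ (q < x ∧ x < r) ∨ s < x) := fun x ↦ by
    simp only [Z, mem_filter, mem_Icc]
  have hqrs : exchangeContext n (p - 1) q r s = Z ∧ exchangeContext n p q r s = insert p Z := by
    constructor <;> ext x <;> simp only [exchangeContext, mem_insert, mem_filter, mem_Icc, mem_Z]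
      <;> omega
  have hprs : exchangeContext n (q - 1) p r s = insert q Z ∧ exchangeContext n q p r s = Z := by
    constructor <;> ext x <;> simp only [exchangeContext, mem_insert, mem_filter, mem_Icc, mem_Z]
      <;> omega
  have hpqs : exchangeContext n (r - 1) p q s = Z ∧ exchangeContext n r p q s = insert r Z := by
    constructor <;> ext x <;> simp only [exchangeContext, mem_insert, mem_filter, mem_Icc, mem_Z]
      <;> omega
  have hpqr : exchangeContext n (s - 1) p q r = insert s Z ∧ exchangeContext n s p q r = Z := by
    constructor <;> ext x <;> simp only [exchangeContext, mem_insert, mem_filter, mem_Icc, mem_Z]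
      <;> omega
  have four_term := hf.rogersl_four_term hp hpq hqr hrs hs (Z := Z) (by rw [mem_Z]; omega)
    (by rw [mem_Z]; omega) (by rw [mem_Z]; omega) (by rw [mem_Z]; omega)
  simp only [exchangeTerm, hqrs, hprs, hpqs, hpqr]
  linarith

theorem sum_Icc_one_sub {G : Type*} [AddCommGroup G] (h : ℕ → G) (n : ℕ) :
    ∑ d ∈ Icc 1 n, (h (d - 1) - h d) = h 0 - h n := by
  induction n with
  | zero => simp only [zero_lt_one, Icc_eq_empty_of_lt, sum_empty, sub_self]
  | succ n ih => rw [sum_Icc_succ_top (by omega), ih, Nat.add_sub_cancel, sub_add_sub_cancel]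

theorem IsPositiveFlag.dilogSum_exchangeRatio {n : ℕ} {f : Finset ℕ → ℝ}
    (hf : IsPositiveFlag n f) :
    dilogSum n (fun a b c ↦ exchangeRatio f (exchangeContext n 0 a b c) a b c) =
      dilogSum n (fun a b c ↦ exchangeRatio f (exchangeContext n n a b c) a b c) := by
  have telescope : ∀ t : ℕ × ℕ × ℕ,
      exchangeTerm n f 0 t.1 t.2.1 t.2.2 - exchangeTerm n f n t.1 t.2.1 t.2.2 =
        ∑ d ∈ Icc 1 n,
          (exchangeTerm n f (d - 1) t.1 t.2.1 t.2.2 - exchangeTerm n f d t.1 t.2.1 t.2.2) :=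
    fun t ↦ (sum_Icc_one_sub (fun m ↦ exchangeTerm n f m t.1 t.2.1 t.2.2) n).symm
  rw [← sub_eq_zero, dilogSum, dilogSum, ← sum_sub_distrib]
  refine (sum_congr rfl fun t _ ↦ telescope t).trans ?_
  rw [sum_tetrahedron_sum_Icc (g := fun a b c d ↦
    exchangeTerm n f (d - 1) a b c - exchangeTerm n f d a b c)]
  · refine sum_eq_zero fun x hx ↦ ?_
    obtain ⟨hp, hpq, hqr, hrs, hs⟩ := mem_quadruples.1 hx
    exact hf.packet_sum_eq_zero hp hpq hqr hrs hs
  · intro a b c d hab hbc hd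
    simp only [exchangeTerm, exchangeContext_sub_one hab hbc hd, sub_self]

/-! ### Maximal minors -/

/-- The minor of `N` with rows `S` and all columns, and `0` unless `S` has as many elements as `N`
has columns. -/
noncomputable def maximalMinor {α R : Type*} [LinearOrder α] [CommRing R] {k : ℕ}
    (N : Matrix α (Fin k) R) (S : Finset α) : R :=
  if h : #S = k then (N.submatrix (S.orderEmbOfFin h) id).det else 0

section MaximalMinor

variable {α R : Type*} [LinearOrder α] [CommRing R] {k : ℕ} {S X : Finset α}

theorem maximalMinor_eq_det (N : Matrix α (Fin k) R) (h : #S = k) :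
    maximalMinor N S = (N.submatrix (S.orderEmbOfFin h) id).det :=
  dif_pos h

theorem maximalMinor_image (N : Matrix α (Fin k) R) {f : Fin k → α} (hf : StrictMono f) :
    maximalMinor N (univ.image f) = (N.submatrix f id).det := by
  have hcard : #(univ.image f) = k := by
    rw [card_image_of_injective _ hf.injective, card_univ, Fintype.card_fin]
  rw [maximalMinor_eq_det N hcard,
    ← orderEmbOfFin_unique hcard (fun i ↦ mem_image_of_mem f (mem_univ i)) hf]

theorem maximalMinor_mul (N : Matrix α (Fin k) R) (K : Matrix (Fin k) (Fin k) R) :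
    maximalMinor (N * K) S = maximalMinor N S * K.det := by
  by_cases h : #S = k
  · rw [maximalMinor_eq_det _ h, maximalMinor_eq_det _ h, ← Matrix.det_mul]
    rfl
  · simp only [maximalMinor, dif_neg h, zero_mul]

theorem maximalMinor_submatrix_perm (N : Matrix α (Fin k) R) (σ : Equiv.Perm (Fin k)) :
    maximalMinor (N.submatrix id σ) S = Equiv.Perm.sign σ * maximalMinor N S := by
  by_cases h : #S = k
  · rw [maximalMinor_eq_det _ h, maximalMinor_eq_det _ h, ← Matrix.det_permute' σ]
    rfl
  · simp only [maximalMinor, dif_neg h, mul_zero]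

theorem maximalMinor_map_rev {n : ℕ} (N : Matrix (Fin n) (Fin k) R) (S : Finset (Fin n)) :
    maximalMinor (N.submatrix Fin.rev Fin.rev) (S.map Fin.revPerm.toEmbedding) =
      maximalMinor N S := by
  by_cases h : #S = k
  · have hmono : StrictMono (Fin.rev ∘ S.orderEmbOfFin h ∘ Fin.rev) :=
      Fin.rev_strictAnti.comp ((S.orderEmbOfFin h).strictMono.comp_strictAnti Fin.rev_strictAnti)
    have himage : S.map Fin.revPerm.toEmbedding =
        univ.image (Fin.rev ∘ S.orderEmbOfFin h ∘ Fin.rev) := by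
      rw [← image_image, ← image_image, image_univ_of_surjective Fin.rev_surjective,
        image_orderEmbOfFin_univ, map_eq_image]
      rfl
    rw [himage, maximalMinor_image _ hmono, maximalMinor_eq_det N h,
      ← Matrix.det_submatrix_equiv_self Fin.revPerm (N.submatrix (S.orderEmbOfFin h) id)]
    congr 1
    ext i j
    simp only [Matrix.submatrix_apply, Function.comp_apply, Fin.rev_rev, id_eq,
      Fin.revPerm_apply]
  · simp only [maximalMinor, card_map, dif_neg h]

theorem card_filter_lt_image {f : Fin k → α} (hf : StrictMono f) (i : Fin k) :
    #{t ∈ univ.image f | t < f i} = i := by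
  simp only [filter_image, hf.lt_iff_lt, card_image_of_injective _ hf.injective,
    filter_gt_eq_Iio, Fin.card_Iio]

theorem card_filter_lt_orderEmbOfFin (h : #S = k) (i : Fin k) :
    #{t ∈ S | t < S.orderEmbOfFin h i} = i := by
  simpa only [image_orderEmbOfFin_univ] using
    card_filter_lt_image (S.orderEmbOfFin h).strictMono i

theorem maximalMinor_erase (N : Matrix α (Fin k) R) (h : #S = k + 1) (i : Fin (k + 1)) :
    maximalMinor N (S.erase (S.orderEmbOfFin h i)) =
      (N.submatrix (S.orderEmbOfFin h ∘ i.succAbove) id).det := by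
  have himage : S.erase (S.orderEmbOfFin h i) = univ.image (S.orderEmbOfFin h ∘ i.succAbove) := by
    rw [← image_image, Fin.image_succAbove_univ, compl_eq_univ_sdiff,
      image_sdiff _ _ (S.orderEmbOfFin h).injective, image_orderEmbOfFin_univ,
      image_singleton, sdiff_singleton_eq_erase]
  rw [himage, maximalMinor_image _
    ((S.orderEmbOfFin h).strictMono.comp i.strictMono_succAbove)]

theorem sum_maximalMinor_erase_mul (N : Matrix α (Fin k) R) (h : #S = k + 1) (l : Fin k) :
    ∑ s ∈ S, (-1) ^ #{t ∈ S | t < s} * maximalMinor N (S.erase s) * N s l = 0 := by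
  let g := S.orderEmbOfFin h
  let B : Matrix (Fin (k + 1)) (Fin (k + 1)) R := .of fun i ↦ Fin.cons (N (g i) l) (N (g i))
  have hB : B.det = 0 := Matrix.det_zero_of_column_eq (Fin.succ_ne_zero l).symm fun i ↦ rfl
  rw [← hB, Matrix.det_succ_column_zero, ← image_orderEmbOfFin_univ S h,
    sum_image g.injective.injOn]
  refine sum_congr rfl fun i _ ↦ ?_
  rw [image_orderEmbOfFin_univ S h, card_filter_lt_orderEmbOfFin, maximalMinor_erase,
    mul_right_comm]
  rfl

/-- The coefficients of the linear form that expands a maximal minor with rows `insert s X` along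
its row `s`, up to the sign determined by the position of `s`. -/
noncomputable def maximalCofactor (N : Matrix α (Fin (k + 1)) R) (X : Finset α) (j : Fin (k + 1)) :
    R :=
  (-1) ^ (j : ℕ) * maximalMinor (N.submatrix id j.succAbove) X

theorem sum_mul_maximalCofactor_of_mem (N : Matrix α (Fin (k + 1)) R) (hX : #X = k) {s : α}
    (hs : s ∈ X) : ∑ j, N s j * maximalCofactor N X j = 0 := by
  obtain ⟨i, rfl⟩ : ∃ i, X.orderEmbOfFin hX i = s := by
    rwa [← Set.mem_range, range_orderEmbOfFin, mem_coe]
  let B : Matrix (Fin (k + 1)) (Fin (k + 1)) R :=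
    .of (Fin.cons (N (X.orderEmbOfFin hX i)) fun i ↦ N (X.orderEmbOfFin hX i))
  have hB : B.det = 0 := Matrix.det_zero_of_row_eq (Fin.succ_ne_zero i).symm rfl
  rw [← hB, Matrix.det_succ_row_zero]
  refine sum_congr rfl fun j _ ↦ ?_
  rw [maximalCofactor, maximalMinor_eq_det _ hX, mul_left_comm, mul_assoc]
  rfl

theorem sum_mul_maximalCofactor_of_notMem (N : Matrix α (Fin (k + 1)) R) (hX : #X = k) {s : α}
    (hs : s ∉ X) :
    ∑ j, N s j * maximalCofactor N X j =
      (-1) ^ #{t ∈ X | t < s} * maximalMinor N (insert s X) := by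
  have hcard : #(insert s X) = k + 1 := by rw [card_insert_of_notMem hs, hX]
  obtain ⟨p, hp⟩ : ∃ p, (insert s X).orderEmbOfFin hcard p = s := by
    rw [← Set.mem_range, range_orderEmbOfFin]
    exact mem_insert_self s X
  have hpos : #{t ∈ X | t < s} = p := by
    rw [← card_filter_lt_orderEmbOfFin hcard p, hp, filter_insert, if_neg (lt_irrefl s)]
  have hminor : ∀ j, maximalMinor (N.submatrix id (Fin.succAbove j)) X =
      (N.submatrix ((insert s X).orderEmbOfFin hcard ∘ p.succAbove) (id ∘ j.succAbove)).det := by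
    intro j
    have herase : (insert s X).erase ((insert s X).orderEmbOfFin hcard p) = X := by
      rw [hp, erase_insert hs]
    have := maximalMinor_erase (N.submatrix id j.succAbove) hcard p
    rwa [herase] at this
  rw [hpos, maximalMinor_eq_det N hcard, Matrix.det_succ_row _ p, mul_sum]
  refine sum_congr rfl fun j _ ↦ ?_
  rw [maximalCofactor, hminor, Matrix.submatrix_apply, hp, id_eq, Matrix.submatrix_submatrix,
    pow_add]
  have hsign : ((-1) ^ (p : ℕ) * (-1) ^ (p : ℕ) : R) = 1 := by
    rw [← mul_pow, neg_one_mul, neg_neg, one_pow]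
  linear_combination (-N s j * (-1) ^ (j : ℕ) *
    (N.submatrix ((insert s X).orderEmbOfFin hcard ∘ p.succAbove) (id ∘ j.succAbove)).det) * hsign

theorem sum_maximalMinor_erase_mul_sum {l : ℕ} (N : Matrix α (Fin k) R) (hS : #S = k + 1)
    (e : Fin l → Fin k) (v : Fin l → R) :
    ∑ s ∈ S, (-1) ^ #{t ∈ S | t < s} * maximalMinor N (S.erase s) * ∑ i, N s (e i) * v i = 0 := by
  simp only [mul_sum]
  rw [sum_comm]
  refine sum_eq_zero fun i _ ↦ ?_
  simp only [← mul_assoc, ← sum_mul]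
  exact mul_eq_zero_of_left (sum_maximalMinor_erase_mul N hS _) _

theorem maximalMinor_three_term (N : Matrix α (Fin (k + 2)) R) (j : Fin (k + 2)) (hX : #X = k)
    {a b c : α} (hab : a < b) (hbc : b < c) (ha : a ∉ X) (hb : b ∉ X) (hc : c ∉ X) :
    maximalMinor (N.submatrix id j.succAbove) (insert b X) *
        maximalMinor N (insert a (insert c X)) =
      maximalMinor N (insert a (insert b X)) *
          maximalMinor (N.submatrix id j.succAbove) (insert c X) +
        maximalMinor (N.submatrix id j.succAbove) (insert a X) *
          maximalMinor N (insert b (insert c X)) := by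
  let N' := N.submatrix id j.succAbove
  let sgn : α → R := fun s ↦ (-1) ^ #{t ∈ X | t < s}
  let S := insert a (insert b (insert c X))
  let ε : α → R := fun s ↦ (-1) ^ #{t ∈ S | t < s}
  have hac := hab.trans hbc
  have haS : a ∉ insert b (insert c X) := by simp [ha, hab.ne, hac.ne]
  have hbS : b ∉ insert c X := by simp [hb, hbc.ne]
  have hS : #S = k + 3 := by
    rw [card_insert_of_notMem haS, card_insert_of_notMem hbS, card_insert_of_notMem hc, hX]
  have expand : ∑ s ∈ S, ε s * maximalMinor N (S.erase s) *
      ∑ i, N' s i * maximalCofactor N' X i = 0 :=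
    sum_maximalMinor_erase_mul_sum N hS j.succAbove _
  have vanish : ∀ s ∈ X, ε s * maximalMinor N (S.erase s) *
      ∑ i, N' s i * maximalCofactor N' X i = 0 := fun s hs ↦ by
    rw [sum_mul_maximalCofactor_of_mem N' hX hs, mul_zero]
  have sgn_a : ε a = sgn a := by
    simp [ε, sgn, S, filter_insert, hab.not_gt, hac.not_gt]
  have sgn_b : ε b = -sgn b := by
    simp [ε, sgn, S, filter_insert, hab, hbc.not_gt, ha, pow_succ]
  have sgn_c : ε c = sgn c := by
    simp [ε, sgn, S, filter_insert, hac, hbc, hab.ne, ha, hb, pow_succ]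
  have sgn_sq : ∀ s, sgn s * sgn s = 1 := fun s ↦ by
    rw [← mul_pow, neg_one_mul, neg_neg, one_pow]
  have erase_a : S.erase a = insert b (insert c X) := erase_insert haS
  have erase_b : S.erase b = insert a (insert c X) := by
    rw [erase_insert_of_ne hab.ne, erase_insert hbS]
  have erase_c : S.erase c = insert a (insert b X) := by
    rw [erase_insert_of_ne hac.ne, erase_insert_of_ne hbc.ne, erase_insert hc]
  rw [sum_insert haS, sum_insert hbS, sum_insert hc, sum_eq_zero vanish, add_zero,
    sum_mul_maximalCofactor_of_notMem N' hX ha, sum_mul_maximalCofactor_of_notMem N' hX hb,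
    sum_mul_maximalCofactor_of_notMem N' hX hc, erase_a, erase_b, erase_c, sgn_a, sgn_b,
    sgn_c] at expand
  linear_combination
    maximalMinor N (insert b (insert c X)) * maximalMinor N' (insert a X) * sgn_sq a -
    maximalMinor N (insert a (insert c X)) * maximalMinor N' (insert b X) * sgn_sq b +
    maximalMinor N (insert a (insert b X)) * maximalMinor N' (insert c X) * sgn_sq c - expand

end MaximalMinor

/-! ### Minors of unitriangular matrices -/

section Minors

variable {α R : Type*} [CommRing R] {k l n : ℕ}

theorem det_submatrix_append (M : Matrix α α R) (I₁ J₁ : Fin k → α) (I₂ J₂ : Fin l → α)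
    (h : ∀ i j, M (I₂ i) (J₁ j) = 0) :
    (M.submatrix (Fin.append I₁ I₂) (Fin.append J₁ J₂)).det =
      (M.submatrix I₁ J₁).det * (M.submatrix I₂ J₂).det := by
  rw [← det_submatrix_equiv_self finSumFinEquiv, submatrix_submatrix,
    ← det_fromBlocks_zero₂₁ _ (M.submatrix I₁ J₂)]
  congr 1
  ext (i | i) (j | j) <;> simp [h]

theorem strictMono_append [Preorder α] {f : Fin k → α} {g : Fin l → α} (hf : StrictMono f)
    (hg : StrictMono g) (h : ∀ i j, f i < g j) : StrictMono (Fin.append f g) := by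
  intro i j hij
  induction i using Fin.addCases <;> induction j using Fin.addCases <;>
    simp only [Fin.append_left, Fin.append_right]
  · exact hf hij
  · exact h _ _
  · exact absurd hij (by simp only [Fin.lt_def, Fin.val_natAdd, Fin.val_castAdd]; omega)
  · exact hg (by simpa only [Fin.natAdd_lt_natAdd_iff] using hij)

theorem det_submatrix_eq_zero_of_isUpperTriangular [LinearOrder α] {M : Matrix α α R}
    (hM : M.IsUpperTriangular) {I J : Fin k → α} (hI : Monotone I) (hJ : Monotone J) {i : Fin k}
    (hi : J i < I i) : (M.submatrix I J).det = 0 := by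
  rw [det_apply]
  refine sum_eq_zero fun σ _ ↦ ?_
  obtain ⟨j, hj, hij⟩ : ∃ j, j ≤ i ∧ i ≤ σ j := by
    by_contra! hlt
    have hcard := card_le_card_of_injOn σ (fun j hj ↦ mem_Iio.2 (hlt j (mem_Iic.1 hj)))
      σ.injective.injOn
    simp only [Fin.card_Iic, Fin.card_Iio, add_le_iff_nonpos_right, nonpos_iff_eq_zero,
      one_ne_zero] at hcard
  rw [prod_eq_zero (mem_univ j), smul_zero]
  exact hM ((hJ hj).trans_lt (hi.trans_le (hI hij)))

theorem sub_le_sub_apply_of_strictMono {I : Fin k → Fin n} (hI : StrictMono I) (i : Fin k) :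
    k - (i : ℕ) ≤ n - I i := by
  have hcard := card_le_card_of_injOn (s := Ici i) (t := Ici (I i)) I
    (fun j hj ↦ mem_Ici.2 (hI.monotone (mem_Ici.1 hj))) hI.injective.injOn
  rwa [Fin.card_Ici, Fin.card_Ici] at hcard

end Minors

namespace IsUpperUnitriangular

variable {n k : ℕ} {M : Matrix (Fin n) (Fin n) ℝ}

theorem isUpperTriangular (hM : IsUpperUnitriangular M) : M.IsUpperTriangular :=
  fun i j hij ↦ hM.1 i j hij

theorem det_submatrix_self (hM : IsUpperUnitriangular M) {I : Fin k → Fin n} (hI : StrictMono I) :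
    (M.submatrix I I).det = 1 := by
  have hupper : (M.submatrix I I).IsUpperTriangular := fun i j hij ↦ hM.1 _ _ (hI hij)
  rw [det_of_isUpperTriangular hupper]
  exact prod_eq_one fun i _ ↦ hM.2 (I i)

theorem exists_det_submatrix_ne_zero {I J : Fin k → Fin n} (hI : StrictMono I)
    (hJ : StrictMono J) (h : ∀ i, I i ≤ J i) :
    ∃ H : Matrix (Fin n) (Fin n) ℝ, IsUpperUnitriangular H ∧ (H.submatrix I J).det ≠ 0 := by
  classical
  let H : Matrix (Fin n) (Fin n) ℝ := .of fun i j ↦ if i = j ∨ ∃ l, I l = i ∧ J l = j then 1 else 0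
  have hH : IsUpperUnitriangular H := by
    refine ⟨fun i j hij ↦ if_neg ?_, fun i ↦ if_pos (Or.inl rfl)⟩
    rintro (rfl | ⟨l, rfl, rfl⟩)
    exacts [hij.false, (h l).not_gt hij]
  have hlower : (H.submatrix I J).IsLowerTriangular := by
    intro i j (hij : i < j)
    refine if_neg ?_
    rintro (heq | ⟨l, hIl, hJl⟩)
    · exact ((hI hij).trans_le (h j)).ne heq
    · exact hij.ne ((hI.injective hIl).symm.trans (hJ.injective hJl))
  have hdiag : ∀ i, H.submatrix I J i i = 1 := fun i ↦ if_pos (Or.inr ⟨i, rfl, rfl⟩)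
  refine ⟨H, hH, ?_⟩
  rw [det_of_isLowerTriangular _ hlower, prod_eq_one fun i _ ↦ hdiag i]
  exact one_ne_zero

end IsUpperUnitriangular

theorem isTotallyPositiveUnitriangular_iff {n : ℕ} {M : Matrix (Fin n) (Fin n) ℝ} :
    IsTotallyPositiveUnitriangular M ↔ IsUpperUnitriangular M ∧
      ∀ (k : ℕ) (I J : Fin k → Fin n), StrictMono I → StrictMono J → (∀ i, I i ≤ J i) →
        0 < (M.submatrix I J).det := by
  refine and_congr_right fun _ ↦ ⟨fun h k I J hI hJ hIJ ↦ ?_, fun h k I J ↦ ?_⟩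
  · exact h k (OrderEmbedding.ofStrictMono I hI) (OrderEmbedding.ofStrictMono J hJ)
      (IsUpperUnitriangular.exists_det_submatrix_ne_zero hI hJ hIJ)
  · rintro ⟨H, hH, hne⟩
    refine h k I J I.strictMono J.strictMono fun i ↦ ?_
    by_contra! hlt
    exact hne (det_submatrix_eq_zero_of_isUpperTriangular hH.isUpperTriangular I.monotone J.monotone
      hlt)

/-! ### Flag minors -/

/-- The indices `s, s + 1, …, s + m - 1`. -/
def consecutive {m n : ℕ} (s : ℕ) (h : s + m ≤ n) (i : Fin m) : Fin n :=
  ⟨s + i, by omega⟩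

theorem strictMono_consecutive {m n s : ℕ} (h : s + m ≤ n) :
    StrictMono (consecutive (m := m) s h) :=
  fun _ _ hij ↦ Nat.add_lt_add_left hij s

theorem exists_consecutive_eq_iff {m n s : ℕ} (h : s + m ≤ n) {x : Fin n} :
    (∃ i : Fin m, consecutive s h i = x) ↔ s ≤ x ∧ x < s + m := by
  constructor
  · rintro ⟨i, rfl⟩
    exact ⟨Nat.le_add_right _ _, Nat.add_lt_add_left i.isLt s⟩
  · rintro ⟨hs, hm⟩
    exact ⟨⟨x - s, by omega⟩, Fin.ext (Nat.add_sub_cancel' hs)⟩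

theorem rev_comp_consecutive_comp_rev {m n s : ℕ} (h : s + m ≤ n) (h' : n - s - m + m ≤ n) :
    Fin.rev ∘ consecutive (m := m) s h ∘ Fin.rev = consecutive (n - s - m) h' := by
  ext i
  simp only [consecutive, Function.comp_apply, Fin.val_rev]
  omega

theorem mem_labelSet {n : ℕ} {I : Finset ℕ} {x : Fin n} : x ∈ labelSet n I ↔ (x : ℕ) + 1 ∈ I := by
  simp only [labelSet, mem_filter, mem_univ, true_and]

theorem exists_val_add_one_eq {n d : ℕ} (h₁ : 1 ≤ d) (h₂ : d ≤ n) :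
    ∃ x : Fin n, (x : ℕ) + 1 = d :=
  ⟨⟨d - 1, by omega⟩, Nat.sub_add_cancel h₁⟩

theorem labelSet_insert {n : ℕ} (x : Fin n) (I : Finset ℕ) :
    labelSet n (insert ((x : ℕ) + 1) I) = insert x (labelSet n I) := by
  ext y
  simp only [mem_labelSet, mem_insert, Nat.add_right_cancel_iff, Fin.ext_iff]

section FlagMinors

variable {n m k : ℕ} {I L : Finset ℕ}

theorem rightFlagMinor_eq_maximalMinor (M : Matrix (Fin n) (Fin n) ℝ) (hm : n - m + m ≤ n)
    (hI : #(labelSet n I) = m) :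
    rightFlagMinor M I = maximalMinor (M.submatrix id (consecutive (n - m) hm)) (labelSet n I) := by
  subst hI
  rw [maximalMinor_eq_det _ rfl]
  rfl

theorem rightFlagMinor_of_labelSet_eq_image (M : Matrix (Fin n) (Fin n) ℝ) (hm : n - m + m ≤ n)
    {f : Fin m → Fin n} (hf : StrictMono f) (hI : labelSet n I = univ.image f) :
    rightFlagMinor M I = (M.submatrix f (consecutive (n - m) hm)).det := by
  have hcard : #(labelSet n I) = m := by
    rw [hI, card_image_of_injective _ hf.injective, card_univ, Fintype.card_fin]
  rw [rightFlagMinor_eq_maximalMinor M hm hcard, hI, maximalMinor_image _ hf]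
  rfl

theorem IsUpperUnitriangular.rightFlagMinor_eq_det {M : Matrix (Fin n) (Fin n) ℝ}
    (hM : IsUpperUnitriangular M) {s : ℕ} (hs : s + k ≤ n) {f : Fin k → Fin n} (hf : StrictMono f)
    (hlt : ∀ i, (f i : ℕ) < s + k)
    (hL : ∀ x : Fin n, (x : ℕ) + 1 ∈ L ↔ (∃ i, f i = x) ∨ s + k ≤ x) :
    rightFlagMinor M L = (M.submatrix f (consecutive s hs)).det := by
  have htail : s + k + (n - (s + k)) ≤ n := by omega
  have hcols : consecutive (n - (k + (n - (s + k)))) (by omega) =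
      Fin.append (consecutive s hs) (consecutive (s + k) htail) := by
    ext i
    induction i using Fin.addCases <;>
      simp only [Fin.append_left, Fin.append_right, consecutive, Fin.val_castAdd,
        Fin.val_natAdd] <;>
      omega
  rw [rightFlagMinor_of_labelSet_eq_image M (m := k + (n - (s + k))) (by omega)
      (f := Fin.append f (consecutive (s + k) htail)), hcols, det_submatrix_append,
    hM.det_submatrix_self (strictMono_consecutive htail), mul_one]
  · exact fun i j ↦ hM.1 _ _ (Fin.lt_def.2 (by simp only [consecutive]; omega))
  · exact strictMono_append hf (strictMono_consecutive htail) fun i j ↦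
      Fin.lt_def.2 ((hlt i).trans_le (Nat.le_add_right _ _))
  · ext x
    have htail_mem : s + k ≤ x ↔ ∃ i, consecutive (s + k) htail i = x := by
      rw [exists_consecutive_eq_iff]
      omega
    simp only [mem_labelSet, hL, htail_mem, mem_image, mem_univ, true_and]
    constructor
    · rintro (⟨i, hi⟩ | ⟨i, hi⟩)
      · exact ⟨Fin.castAdd _ i, by rwa [Fin.append_left]⟩
      · exact ⟨Fin.natAdd _ i, by rwa [Fin.append_right]⟩
    · rintro ⟨i, hi⟩
      induction i using Fin.addCases with
      | left i => exact Or.inl ⟨i, by rwa [Fin.append_left] at hi⟩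
      | right i => exact Or.inr ⟨i, by rwa [Fin.append_right] at hi⟩

theorem IsTotallyPositiveUnitriangular.rightFlagMinor_pos {M : Matrix (Fin n) (Fin n) ℝ}
    (hM : IsTotallyPositiveUnitriangular M) (I : Finset ℕ) : 0 < rightFlagMinor M I := by
  have hrows := ((labelSet n I).orderEmbOfFin rfl).strictMono
  refine (isTotallyPositiveUnitriangular_iff.1 hM).2 _ _ _ hrows
    (strictMono_consecutive (s := n - #(labelSet n I))
      (Nat.sub_add_cancel (labelSet_card_le n I)).le) fun i ↦ ?_
  have := sub_le_sub_apply_of_strictMono hrows i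
  rw [Fin.le_def]
  change _ ≤ n - #(labelSet n I) + i
  omega

theorem rightFlagMinor_eq_maximalMinor_succAbove (M : Matrix (Fin n) (Fin n) ℝ)
    (hm : n - (m + 1) + (m + 1) ≤ n) (hI : #(labelSet n I) = m) :
    rightFlagMinor M I = maximalMinor
      ((M.submatrix id (consecutive (n - (m + 1)) hm)).submatrix id (Fin.succAbove 0))
      (labelSet n I) := by
  rw [rightFlagMinor_eq_maximalMinor M (m := m) (by omega) hI]
  congr 1
  ext i j
  simp only [submatrix_apply, id_eq]
  congr 1
  ext
  simp only [consecutive, Fin.succAbove_zero, Fin.val_succ]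
  omega

theorem IsTotallyPositiveUnitriangular.isPositiveFlag {M : Matrix (Fin n) (Fin n) ℝ}
    (hM : IsTotallyPositiveUnitriangular M) : IsPositiveFlag n (rightFlagMinor M) where
  pos := hM.rightFlagMinor_pos
  three_term := by
    intro X a b c ha hab hbc hc haX hbX hcX
    obtain ⟨a, rfl⟩ := exists_val_add_one_eq (n := n) ha (by omega)
    obtain ⟨b, rfl⟩ := exists_val_add_one_eq (n := n) (d := b) (by omega) (by omega)
    obtain ⟨c, rfl⟩ := exists_val_add_one_eq (d := c) (by omega) hc
    rw [← mem_labelSet] at haX hbX hcX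
    rw [Nat.add_lt_add_iff_right, ← Fin.lt_def] at hab hbc
    let k := #(labelSet n X)
    have card_one : ∀ {x}, x ∉ labelSet n X → #(labelSet n (insert (x + 1 : ℕ) X)) = k + 1 :=
      fun hx ↦ by rw [labelSet_insert, card_insert_of_notMem hx]
    have card_two : ∀ {x y}, x < y → x ∉ labelSet n X → y ∉ labelSet n X →
        #(labelSet n (insert (x + 1 : ℕ) (insert (y + 1 : ℕ) X))) = k + 2 := fun hxy hx hy ↦ by
      rw [labelSet_insert, card_insert_of_notMem, card_one hy]
      rw [labelSet_insert, mem_insert]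
      exact not_or_intro hxy.ne hx
    have hk : n - (k + 2) + (k + 2) ≤ n := by
      have := labelSet_card_le n (insert (a + 1 : ℕ) (insert (b + 1 : ℕ) X))
      rw [card_two hab haX hbX] at this
      omega
    rw [rightFlagMinor_eq_maximalMinor_succAbove M hk (card_one haX),
      rightFlagMinor_eq_maximalMinor_succAbove M hk (card_one hbX),
      rightFlagMinor_eq_maximalMinor_succAbove M hk (card_one hcX),
      rightFlagMinor_eq_maximalMinor M hk (card_two hab haX hbX),
      rightFlagMinor_eq_maximalMinor M hk (card_two (hab.trans hbc) haX hcX),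
      rightFlagMinor_eq_maximalMinor M hk (card_two hbc hbX hcX)]
    simp only [labelSet_insert]
    exact maximalMinor_three_term _ 0 rfl hab hbc haX hbX hcX

end FlagMinors

/-! ### Reflection in the antidiagonal -/

/-- The reflection of `M` in the antidiagonal: the involution of `N_n` that exchanges right and
upper flag minors. -/
def antitranspose {n : ℕ} (M : Matrix (Fin n) (Fin n) ℝ) : Matrix (Fin n) (Fin n) ℝ :=
  Mᵀ.submatrix Fin.rev Fin.rev

/-- The image of `I ⊆ {1, …, n}` under `w₀`, that is, under `x ↦ n + 1 - x`. -/
def reflectLabels (n : ℕ) (I : Finset ℕ) : Finset ℕ :=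
  {x ∈ Icc 1 n | n + 1 - x ∈ I}

section Antitranspose

variable {n k : ℕ} {M : Matrix (Fin n) (Fin n) ℝ}

theorem antitranspose_antitranspose (M : Matrix (Fin n) (Fin n) ℝ) :
    antitranspose (antitranspose M) = M := by
  ext i j
  simp only [antitranspose, submatrix_apply, transpose_apply, Fin.rev_rev]

theorem det_antitranspose_submatrix (M : Matrix (Fin n) (Fin n) ℝ) (I J : Fin k → Fin n) :
    ((antitranspose M).submatrix I J).det =
      (M.submatrix (Fin.rev ∘ J ∘ Fin.rev) (Fin.rev ∘ I ∘ Fin.rev)).det := by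
  rw [← det_transpose, ← det_submatrix_equiv_self Fin.revPerm]
  rfl

theorem IsUpperUnitriangular.antitranspose (hM : IsUpperUnitriangular M) :
    IsUpperUnitriangular (antitranspose M) :=
  ⟨fun _ _ hij ↦ hM.1 _ _ (Fin.rev_lt_rev.2 hij), fun _ ↦ hM.2 _⟩

theorem IsTotallyPositiveUnitriangular.antitranspose (hM : IsTotallyPositiveUnitriangular M) :
    IsTotallyPositiveUnitriangular (antitranspose M) := by
  rw [isTotallyPositiveUnitriangular_iff] at hM ⊢
  have strictMono_rev {k : ℕ} {f : Fin k → Fin n} (hf : StrictMono f) :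
      StrictMono (Fin.rev ∘ f ∘ Fin.rev) :=
    fun _ _ hij ↦ Fin.rev_lt_rev.2 (hf (Fin.rev_lt_rev.2 hij))
  refine ⟨hM.1.antitranspose, fun k I J hI hJ hIJ ↦ ?_⟩
  rw [det_antitranspose_submatrix]
  exact hM.2 k _ _ (strictMono_rev hJ) (strictMono_rev hI) fun i ↦ Fin.rev_le_rev.2 (hIJ _)

theorem labelSet_reflectLabels (n : ℕ) (I : Finset ℕ) :
    labelSet n (reflectLabels n I) = (labelSet n I).map Fin.revPerm.toEmbedding := by
  ext x
  have hx : (x.rev : ℕ) + 1 = n + 1 - (x + 1) := by rw [Fin.val_rev]; omega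
  rw [mem_map_equiv, Fin.revPerm_symm, Fin.revPerm_apply, mem_labelSet, mem_labelSet,
    reflectLabels, mem_filter, mem_Icc, hx]
  exact and_iff_right ⟨Nat.le_add_left 1 x, x.isLt⟩

theorem card_labelSet_reflectLabels (n : ℕ) (I : Finset ℕ) :
    #(labelSet n (reflectLabels n I)) = #(labelSet n I) := by
  rw [labelSet_reflectLabels, card_map]

theorem upperFlagMinor_eq_rightFlagMinor_antitranspose (M : Matrix (Fin n) (Fin n) ℝ)
    (J : Finset ℕ) :
    upperFlagMinor M J = rightFlagMinor (antitranspose M) (reflectLabels n J) := by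
  have hm := labelSet_card_le n J
  have hcols : (antitranspose M).submatrix id (consecutive (n - #(labelSet n J)) (by omega)) =
      (Mᵀ.submatrix id (Fin.castLE hm)).submatrix Fin.rev Fin.rev := by
    ext i j
    have hj : (consecutive (n - #(labelSet n J)) (by omega) j).rev = Fin.castLE hm j.rev := by
      ext
      simp only [consecutive, Fin.val_rev, Fin.val_castLE]
      omega
    simp only [antitranspose, submatrix_apply, id_eq, hj]
  rw [rightFlagMinor_eq_maximalMinor _ (by omega) (card_labelSet_reflectLabels n J), hcols,
    labelSet_reflectLabels, maximalMinor_map_rev, maximalMinor_eq_det _ rfl, upperFlagMinor,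
    ← det_transpose]
  rfl

/-- Both sides are the minor of `M` with the `k` rows starting at `a` and the `k` columns ending
at `c`. -/
theorem IsUpperUnitriangular.rightFlagMinor_eq_upperFlagMinor (hM : IsUpperUnitriangular M)
    {a c : ℕ} (ha : 1 ≤ a) (hac : a + k ≤ c + 1) (hc : c ≤ n) {I J : Finset ℕ}
    (hI : ∀ x, x ∈ I ↔ (a ≤ x ∧ x < a + k) ∨ (c < x ∧ x ≤ n))
    (hJ : ∀ x, x ∈ J ↔ (1 ≤ x ∧ x < a) ∨ (c < x + k ∧ x ≤ c)) :
    rightFlagMinor M I = upperFlagMinor M J := by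
  have hright : rightFlagMinor M I = (M.submatrix (consecutive (m := k) (a - 1) (by omega))
      (consecutive (c - k) (by omega))).det := by
    refine hM.rightFlagMinor_eq_det _ (strictMono_consecutive _) ?_ fun x ↦ ?_
    · intro i
      simp only [consecutive]
      omega
    · rw [hI, exists_consecutive_eq_iff]
      omega
  have hupper : upperFlagMinor M J = ((_root_.antitranspose M).submatrix
      (consecutive (m := k) (n - c) (by omega)) (consecutive (n + 1 - a - k) (by omega))).det := by
    rw [upperFlagMinor_eq_rightFlagMinor_antitranspose]
    refine hM.antitranspose.rightFlagMinor_eq_det _ (strictMono_consecutive _) ?_ fun x ↦ ?_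
    · intro i
      simp only [consecutive]
      omega
    · rw [exists_consecutive_eq_iff, reflectLabels, mem_filter, mem_Icc, hJ]
      omega
  rw [hright, hupper, det_antitranspose_submatrix, rev_comp_consecutive_comp_rev _ (by omega),
    rev_comp_consecutive_comp_rev _ (by omega)]
  congr! 3 <;> omega

end Antitranspose

/-! ### Total positivity from flag minors -/

/-- The increasing list `I` is termwise at most the increasing enumeration of `S`, expressed by
counting elements so that `S` may vary without reference to its enumeration. -/
def IsDominated {α : Type*} [LinearOrder α] {k : ℕ} (I : Fin k → α) (S : Finset α) : Prop :=
  ∀ i, #{s ∈ S | s < I i} ≤ i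

section IsDominated

variable {α : Type*} [LinearOrder α] {k : ℕ} {S X : Finset α}

theorem isDominated_iff_le_orderEmbOfFin {I : Fin k → α} (hS : #S = k) :
    IsDominated I S ↔ ∀ i, I i ≤ S.orderEmbOfFin hS i := by
  refine forall_congr' fun i ↦ ⟨fun hi ↦ ?_, fun hi ↦ ?_⟩
  · by_contra! hlt
    have hssub : {s ∈ S | s < S.orderEmbOfFin hS i} ⊂ {s ∈ S | s < I i} := by
      refine (ssubset_iff_of_subset fun s ↦ ?_).2 ⟨S.orderEmbOfFin hS i, ?_, ?_⟩
      · simp only [mem_filter]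
        exact And.imp_right fun hs ↦ hs.trans hlt
      · exact mem_filter.2 ⟨orderEmbOfFin_mem S hS i, hlt⟩
      · exact fun h ↦ (mem_filter.1 h).2.false
    have := card_lt_card hssub
    rw [card_filter_lt_orderEmbOfFin] at this
    omega
  · rw [← card_filter_lt_orderEmbOfFin hS i]
    exact card_le_card (monotone_filter_right S fun s _ hs ↦ hs.trans_le hi)

theorem IsDominated.insert_of_lt {I : Fin k → α} {a b : α} (hab : a < b) (ha : a ∉ X)
    (h : IsDominated I (insert a X)) : IsDominated I (insert b X) := by
  refine fun i ↦ le_trans ?_ (h i)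
  rw [filter_insert, filter_insert]
  split_ifs with hb ha'
  · rw [card_insert_of_notMem fun hmem ↦ ha (mem_of_mem_filter _ hmem)]
    exact card_insert_le _ _
  · exact absurd (hab.trans hb) ha'
  · exact card_le_card (subset_insert _ _)
  · exact le_rfl

theorem IsDominated.comp_castSucc {I : Fin (k + 1) → α} (h : IsDominated I S) (hX : X ⊆ S) :
    IsDominated (I ∘ Fin.castSucc) X :=
  fun i ↦ (card_le_card (filter_subset_filter _ hX)).trans (h i.castSucc)

theorem eq_Icc_or_exists_gap [LocallyFiniteOrder α] (hS : S.Nonempty) :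
    (∃ a c, S = Icc a c) ∨
      ∃ a b c X, a < b ∧ b < c ∧ b ∉ X ∧ X ⊆ Ioo a c ∧ S = insert a (insert c X) := by
  have hsub : S ⊆ Icc (S.min' hS) (S.max' hS) := fun x hx ↦
    mem_Icc.2 ⟨S.min'_le x hx, S.le_max' x hx⟩
  by_cases h : Icc (S.min' hS) (S.max' hS) ⊆ S
  · exact Or.inl ⟨_, _, hsub.antisymm h⟩
  · obtain ⟨b, hb, hbS⟩ := not_subset.1 h
    have hmin : S.min' hS ≠ b := fun heq ↦ hbS (heq ▸ S.min'_mem hS)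
    have hmax : b ≠ S.max' hS := fun heq ↦ hbS (heq ▸ S.max'_mem hS)
    have hab := (mem_Icc.1 hb).1.lt_of_ne hmin
    have hbc := (mem_Icc.1 hb).2.lt_of_ne hmax
    refine Or.inr ⟨_, b, _, (S.erase (S.max' hS)).erase (S.min' hS), hab, hbc, ?_, ?_, ?_⟩
    · exact fun hmem ↦ hbS (mem_of_mem_erase (mem_of_mem_erase hmem))
    · intro x hx
      obtain ⟨hxmin, hxmax, hx⟩ : x ≠ S.min' hS ∧ x ≠ S.max' hS ∧ x ∈ S := by
        simpa only [mem_erase] using hx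
      exact mem_Ioo.2 ⟨(S.min'_le x hx).lt_of_ne' hxmin, (S.le_max' x hx).lt_of_ne hxmax⟩
    · rw [insert_comm, insert_erase (mem_erase.2 ⟨(hab.trans hbc).ne, S.min'_mem hS⟩),
        insert_erase (S.max'_mem hS)]

end IsDominated

/-- The minor of `A` with rows `I` and columns `S`, and `0` unless `S` has `k` elements. -/
noncomputable def columnMinor {α R : Type*} [LinearOrder α] [CommRing R] {k : ℕ}
    (A : Matrix α α R) (I : Fin k → α) (S : Finset α) : R :=
  maximalMinor (Aᵀ.submatrix id I) S

section ColumnMinor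

variable {n k : ℕ} {A : Matrix (Fin n) (Fin n) ℝ} {S X : Finset (Fin n)}

theorem columnMinor_eq_det (A : Matrix (Fin n) (Fin n) ℝ) (I : Fin k → Fin n) (hS : #S = k) :
    columnMinor A I S = (A.submatrix I (S.orderEmbOfFin hS)).det := by
  rw [columnMinor, maximalMinor_eq_det _ hS, ← det_transpose]
  rfl

theorem columnMinor_image (A : Matrix (Fin n) (Fin n) ℝ) (I : Fin k → Fin n) {J : Fin k → Fin n}
    (hJ : StrictMono J) : columnMinor A I (univ.image J) = (A.submatrix I J).det := by
  rw [columnMinor, maximalMinor_image _ hJ, ← det_transpose]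
  rfl

theorem columnMinor_three_term (A : Matrix (Fin n) (Fin n) ℝ) (I : Fin (k + 2) → Fin n)
    (hX : #X = k) {a b c : Fin n} (hab : a < b) (hbc : b < c) (ha : a ∉ X) (hb : b ∉ X)
    (hc : c ∉ X) :
    columnMinor A (I ∘ Fin.castSucc) (insert b X) * columnMinor A I (insert a (insert c X)) =
      columnMinor A I (insert a (insert b X)) * columnMinor A (I ∘ Fin.castSucc) (insert c X) +
        columnMinor A (I ∘ Fin.castSucc) (insert a X) *
          columnMinor A I (insert b (insert c X)) := by
  have h := maximalMinor_three_term (Aᵀ.submatrix id I) (Fin.last _) hX hab hbc ha hb hc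
  rw [Fin.succAbove_last] at h
  exact h

end ColumnMinor

namespace IsUpperUnitriangular

variable {n k : ℕ} {A : Matrix (Fin n) (Fin n) ℝ} {S X : Finset (Fin n)}

theorem columnMinor_nonneg (hA : IsUpperUnitriangular A) {I : Fin k → Fin n} (hI : StrictMono I)
    (h : #S = k → IsDominated I S → 0 < columnMinor A I S) : 0 ≤ columnMinor A I S := by
  by_cases hS : #S = k
  · by_cases hIS : IsDominated I S
    · exact (h hS hIS).le
    · rw [isDominated_iff_le_orderEmbOfFin hS] at hIS
      push Not at hIS
      obtain ⟨i, hi⟩ := hIS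
      rw [columnMinor_eq_det A I hS, det_submatrix_eq_zero_of_isUpperTriangular
        hA.isUpperTriangular hI.monotone (S.orderEmbOfFin hS).monotone hi]
  · rw [columnMinor, maximalMinor, dif_neg hS]

theorem columnMinor_Icc_pos (hA : IsUpperUnitriangular A) (hpos : ∀ L, 0 < rightFlagMinor A L)
    {I : Fin k → Fin n} (hI : StrictMono I) {a c : Fin n} (hac : #(Icc a c) = k)
    (hdom : IsDominated I (Icc a c)) : 0 < columnMinor A I (Icc a c) := by
  rw [Fin.card_Icc] at hac
  by_cases hk : k = 0
  · subst hk
    rw [columnMinor_eq_det A I (by rw [Fin.card_Icc, hac]), det_isEmpty]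
    exact one_pos
  have hs : (a : ℕ) + k ≤ n := by omega
  have himage : Icc a c = univ.image (consecutive (m := k) a hs) := by
    ext x
    simp only [mem_Icc, mem_image, mem_univ, true_and, exists_consecutive_eq_iff, Fin.le_def]
    omega
  have hlt (i : Fin k) : (I i : ℕ) < a + k := by
    rw [himage] at hdom
    by_contra! hle
    have hfilter : {s ∈ univ.image (consecutive (m := k) a hs) | s < I i} =
        univ.image (consecutive (m := k) a hs) := by
      refine filter_true_of_mem fun s hmem ↦ ?_
      obtain ⟨j, -, rfl⟩ := mem_image.1 hmem
      exact Fin.lt_def.2 ((Nat.add_lt_add_left j.isLt a).trans_le hle)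
    have := hdom i
    rw [hfilter, card_image_of_injective _ (strictMono_consecutive hs).injective, card_univ,
      Fintype.card_fin] at this
    omega
  rw [himage, columnMinor_image A I (strictMono_consecutive hs),
    ← hA.rightFlagMinor_eq_det hs hI hlt
      (L := {x ∈ Icc 1 n | (∃ i, (I i : ℕ) + 1 = x) ∨ (a : ℕ) + k < x})]
  · exact hpos _
  · intro x
    simp only [mem_filter, mem_Icc, Fin.ext_iff, Nat.add_right_cancel_iff, Nat.lt_succ_iff]
    exact and_iff_right ⟨Nat.le_add_left 1 x, x.isLt⟩

theorem columnMinor_pos_of_gap (hA : IsUpperUnitriangular A)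
    (ih : ∀ (J : Fin (k + 1) → Fin n) (S : Finset (Fin n)), StrictMono J → #S = k + 1 →
      IsDominated J S → 0 < columnMinor A J S)
    {I : Fin (k + 2) → Fin n} (hI : StrictMono I) {a b c : Fin n} (hab : a < b) (hbc : b < c)
    (haX : a ∉ X) (hbX : b ∉ X) (hcX : c ∉ X) (hX : #X = k)
    (hlow : #(insert a (insert b X)) = k + 2 → IsDominated I (insert a (insert b X)) →
      0 < columnMinor A I (insert a (insert b X)))
    (hhigh : #(insert b (insert c X)) = k + 2 → IsDominated I (insert b (insert c X)) →
      0 < columnMinor A I (insert b (insert c X)))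
    (hdom : IsDominated I (insert a (insert c X))) :
    0 < columnMinor A I (insert a (insert c X)) := by
  have hI' : StrictMono (I ∘ Fin.castSucc) := hI.comp Fin.strictMono_castSucc
  have card_insert {x : Fin n} (hx : x ∉ X) : #(insert x X) = k + 1 := by
    rw [card_insert_of_notMem hx, hX]
  have hdom_a : IsDominated (I ∘ Fin.castSucc) (insert a X) :=
    hdom.comp_castSucc (insert_subset_insert a (subset_insert c X))
  have pos_a := ih _ _ hI' (card_insert haX) hdom_a
  have pos_b := ih _ _ hI' (card_insert hbX) (hdom_a.insert_of_lt hab haX)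
  have nonneg_c : 0 ≤ columnMinor A (I ∘ Fin.castSucc) (insert c X) :=
    hA.columnMinor_nonneg hI' (ih _ _ hI')
  have nonneg_ab := hA.columnMinor_nonneg hI hlow
  have pos_bc : 0 < columnMinor A I (insert b (insert c X)) := by
    refine hhigh ?_ (hdom.insert_of_lt hab ?_)
    · rw [card_insert_of_notMem (by simp only [mem_insert, hbc.ne, hbX, or_self, not_false_iff]),
        card_insert hcX]
    · simp only [mem_insert, (hab.trans hbc).ne, haX, or_self, not_false_iff]
  refine pos_of_mul_pos_right ?_ pos_b.le
  rw [columnMinor_three_term A I hX hab hbc haX hbX hcX]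
  exact add_pos_of_nonneg_of_pos (mul_nonneg nonneg_ab nonneg_c) (mul_pos pos_a pos_bc)

theorem columnMinor_pos (hA : IsUpperUnitriangular A) (hpos : ∀ L, 0 < rightFlagMinor A L)
    (I : Fin k → Fin n) (S : Finset (Fin n)) (hI : StrictMono I) (hS : #S = k)
    (hdom : IsDominated I S) : 0 < columnMinor A I S := by
  induction k generalizing S with
  | zero =>
    rw [columnMinor_eq_det A I hS, det_isEmpty]
    exact one_pos
  | succ k ih =>
    suffices ∀ w u, (∀ x ∈ S, u ≤ (x : ℕ) ∧ (x : ℕ) < u + w) → 0 < columnMinor A I S from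
      this n 0 fun x _ ↦ ⟨Nat.zero_le _, by omega⟩
    intro w
    induction w using Nat.strong_induction_on generalizing S with | _ w ihw
    intro u hu
    have hne : S.Nonempty := card_pos.1 (by omega)
    obtain ⟨a, c, rfl⟩ | ⟨a, b, c, X, hab, hbc, hbX, hX, rfl⟩ := eq_Icc_or_exists_gap hne
    · exact hA.columnMinor_Icc_pos hpos hI hS hdom
    have haX : a ∉ X := fun h ↦ (mem_Ioo.1 (hX h)).1.false
    have hcX : c ∉ X := fun h ↦ (mem_Ioo.1 (hX h)).2.false
    rw [card_insert_of_notMem (by simp only [mem_insert, (hab.trans hbc).ne, haX, or_self,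
      not_false_iff]), card_insert_of_notMem hcX] at hS
    obtain rfl : k = #X + 1 := by omega
    have hua := hu a (mem_insert_self _ _)
    have huc := hu c (mem_insert_of_mem (mem_insert_self _ _))
    rw [Fin.lt_def] at hab hbc
    refine hA.columnMinor_pos_of_gap ih hI hab hbc haX hbX hcX rfl ?_ ?_ hdom
    · refine fun hcard hdom' ↦ ihw (c - a) (by omega) _ hcard hdom' a fun x hx ↦ ?_
      obtain rfl | rfl | hx := by simpa only [mem_insert] using hx
      · omega
      · omega
      · have := mem_Ioo.1 (hX hx)
        omega
    · refine fun hcard hdom' ↦ ihw (c - a) (by omega) _ hcard hdom' (a + 1) fun x hx ↦ ?_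
      obtain rfl | rfl | hx := by simpa only [mem_insert] using hx
      · omega
      · omega
      · have := mem_Ioo.1 (hX hx)
        omega

/-- Fekete's criterion: the induction lowers the number of columns and, by the three-term relation,
fills the gaps between them until they are consecutive. -/
theorem isTotallyPositiveUnitriangular (hA : IsUpperUnitriangular A)
    (hpos : ∀ L, 0 < rightFlagMinor A L) : IsTotallyPositiveUnitriangular A := by
  refine isTotallyPositiveUnitriangular_iff.2 ⟨hA, fun k I J hI hJ hIJ ↦ ?_⟩
  rw [← columnMinor_image A I hJ]
  have hcard : #(univ.image J) = k := by
    rw [card_image_of_injective _ hJ.injective, card_univ, Fintype.card_fin]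
  refine hA.columnMinor_pos hpos I _ hI hcard fun i ↦ ?_
  rw [← card_filter_lt_image hJ i]
  exact card_le_card (monotone_filter_right _ fun s _ hs ↦ hs.trans_le (hIJ i))

end IsUpperUnitriangular

/-! ### Triangular factorizations -/

section Triangular

variable {ι K : Type*} [Fintype ι] [LinearOrder ι] [Field K] {X : Matrix ι ι K}

theorem exists_mul_isUpperTriangular
    (hX : ∀ j : ι, (X.submatrix ((↑) : {i // j ≤ i} → ι) (↑)).det ≠ 0) :
    ∃ L : Matrix ι ι K, L.IsLowerTriangular ∧ (X * L).IsUpperTriangular ∧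
      ∀ i, (X * L) i i = 1 := by
  let C (j : ι) : Matrix {i // j ≤ i} {i // j ≤ i} K := X.submatrix (↑) (↑)
  let v (j : ι) : {i // j ≤ i} → K := (C j)⁻¹ *ᵥ Pi.single ⟨j, le_rfl⟩ 1
  have hv : ∀ j, C j *ᵥ v j = Pi.single ⟨j, le_rfl⟩ 1 := fun j ↦ by
    rw [mulVec_mulVec, mul_nonsing_inv (C j) (hX j).isUnit, one_mulVec]
  let L : Matrix ι ι K := .of fun l j ↦ if h : j ≤ l then v j ⟨l, h⟩ else 0
  have hL : L.IsLowerTriangular := fun i j (hij : i < j) ↦ dif_neg hij.not_ge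
  have hXL : ∀ i j (h : j ≤ i), (X * L) i j =
      (Pi.single ⟨j, le_rfl⟩ 1 : {i // j ≤ i} → K) ⟨i, h⟩ := by
    intro i j h
    rw [← hv j, mul_apply,
      ← sum_subset (subset_univ {l | j ≤ l}) fun l _ hl ↦ by
        rw [hL (not_le.1 fun hjl ↦ hl (mem_filter.2 ⟨mem_univ l, hjl⟩)), mul_zero],
      sum_subtype (p := fun l ↦ j ≤ l) _ fun l ↦ by simp only [mem_filter, mem_univ, true_and]]
    refine sum_congr rfl fun l _ ↦ ?_
    rw [show L l j = v j l from dif_pos l.2]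
    rfl
  refine ⟨L, hL, fun i j (hij : j < i) ↦ ?_, fun i ↦ ?_⟩
  · rw [hXL i j hij.le, Pi.single_eq_of_ne fun h ↦ hij.ne' (congrArg Subtype.val h)]
  · rw [hXL i i le_rfl, Pi.single_eq_same]

theorem exists_eq_upper_mul_lower
    (hX : ∀ j : ι, (X.submatrix ((↑) : {i // j ≤ i} → ι) (↑)).det ≠ 0) :
    ∃ U L : Matrix ι ι K, U.IsUpperTriangular ∧ (∀ i, U i i = 1) ∧ L.IsLowerTriangular ∧
      (∀ i, L i i ≠ 0) ∧ X = U * L := by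
  obtain ⟨L, hL, hU, hdiag⟩ := exists_mul_isUpperTriangular hX
  have hdet : X.det * L.det = 1 := by
    rw [← Matrix.det_mul, det_of_isUpperTriangular hU, prod_eq_one fun i _ ↦ hdiag i]
  have hunit : IsUnit L.det := .of_mul_eq_one X.det (by rw [mul_comm, hdet])
  let := invertibleOfIsUnitDet L hunit
  have hinv : L⁻¹.IsLowerTriangular := blockTriangular_inv_of_blockTriangular hL
  have hne : L⁻¹.det ≠ 0 := (isUnit_nonsing_inv_det_iff.2 hunit).ne_zero
  rw [det_of_isLowerTriangular _ hinv, prod_ne_zero_iff] at hne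
  exact ⟨X * L, L⁻¹, hU, hdiag, hinv, fun i ↦ hne i (mem_univ i), by
    rw [Matrix.mul_assoc, mul_nonsing_inv _ hunit, Matrix.mul_one]⟩

end Triangular

/-! ### The Gauss decomposition -/

section Antidiagonal

variable {n : ℕ}

theorem antidiagonalMatrix_mul (M : Matrix (Fin n) (Fin n) ℝ) :
    antidiagonalMatrix n * M = M.submatrix Fin.rev id := by
  ext i j
  rw [mul_apply, sum_eq_single i.rev (fun l _ hl ↦ ?_) (fun h ↦ absurd (mem_univ _) h)]
  · rw [antidiagonalMatrix, of_apply, if_pos (by rw [Fin.val_rev]; omega), one_mul]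
    rfl
  · rw [antidiagonalMatrix, of_apply, if_neg, zero_mul]
    exact fun h ↦ hl (Fin.ext (by rw [Fin.val_rev]; omega))

theorem antidiagonalMatrix_transpose (n : ℕ) :
    (antidiagonalMatrix n)ᵀ = antidiagonalMatrix n := by
  ext i j
  simp only [antidiagonalMatrix, transpose_apply, of_apply, add_comm (j : ℕ)]

theorem mul_antidiagonalMatrix (M : Matrix (Fin n) (Fin n) ℝ) :
    M * antidiagonalMatrix n = M.submatrix id Fin.rev := by
  rw [← transpose_inj, transpose_mul, antidiagonalMatrix_transpose, antidiagonalMatrix_mul]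
  rfl

theorem antidiagonalMatrix_mul_self (n : ℕ) :
    antidiagonalMatrix n * antidiagonalMatrix n = 1 := by
  have hP : antidiagonalMatrix n = (1 : Matrix (Fin n) (Fin n) ℝ).submatrix id Fin.rev := by
    rw [← mul_antidiagonalMatrix, Matrix.one_mul]
  rw [mul_antidiagonalMatrix, hP, submatrix_submatrix, Fin.rev_involutive.comp_self]
  rfl

theorem antitranspose_eq (M : Matrix (Fin n) (Fin n) ℝ) :
    antitranspose M = antidiagonalMatrix n * Mᵀ * antidiagonalMatrix n := by
  rw [antidiagonalMatrix_mul, mul_antidiagonalMatrix]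
  rfl

end Antidiagonal

section FlagMinors

variable {n m : ℕ} {I : Finset ℕ}

theorem rightFlagMinor_mul_of_isLowerTriangular (A : Matrix (Fin n) (Fin n) ℝ)
    {L : Matrix (Fin n) (Fin n) ℝ} (hL : L.IsLowerTriangular) (hm : n - m + m ≤ n)
    (hI : #(labelSet n I) = m) :
    rightFlagMinor (A * L) I = rightFlagMinor A I *
      (L.submatrix (consecutive (n - m) hm) (consecutive (n - m) hm)).det := by
  let cols : Fin m → Fin n := consecutive (n - m) hm
  have hmul : (A * L).submatrix id cols = A.submatrix id cols * L.submatrix cols cols := by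
    ext i j
    rw [mul_apply, submatrix_apply, mul_apply]
    have hcols := (strictMono_consecutive hm).injective
    refine (sum_subset (subset_univ (univ.image cols)) fun l _ hl ↦ ?_).symm.trans
      (sum_image hcols.injOn)
    have hlt : l < cols j := by
      simp only [mem_image, mem_univ, true_and, cols, exists_consecutive_eq_iff] at hl
      simp only [cols, consecutive, Fin.lt_def]
      omega
    rw [show L l (cols j) = 0 from hL hlt, mul_zero]
  rw [rightFlagMinor_eq_maximalMinor _ hm hI, rightFlagMinor_eq_maximalMinor _ hm hI, hmul,
    maximalMinor_mul]

theorem labelSet_Icc (hm : n - m + m ≤ n) :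
    labelSet n (Icc (n - m + 1) n) = univ.image (consecutive (m := m) (n - m) hm) := by
  ext x
  simp only [mem_labelSet, mem_Icc, mem_image, mem_univ, true_and, exists_consecutive_eq_iff]
  omega

theorem card_labelSet_Icc (hm : n - m + m ≤ n) : #(labelSet n (Icc (n - m + 1) n)) = m := by
  rw [labelSet_Icc hm, card_image_of_injective _ (strictMono_consecutive hm).injective, card_univ,
    Fintype.card_fin]

theorem IsUpperUnitriangular.rightFlagMinor_Icc {A : Matrix (Fin n) (Fin n) ℝ}
    (hA : IsUpperUnitriangular A) (hm : n - m + m ≤ n) :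
    rightFlagMinor A (Icc (n - m + 1) n) = 1 := by
  rw [rightFlagMinor_of_labelSet_eq_image A hm (strictMono_consecutive hm) (labelSet_Icc hm),
    hA.det_submatrix_self (strictMono_consecutive hm)]

theorem rightFlagMinor_reflectLabels (M : Matrix (Fin n) (Fin n) ℝ)
    (hI : #(labelSet n I) = m) :
    rightFlagMinor M (reflectLabels n I) =
      Equiv.Perm.sign (Fin.revPerm : Equiv.Perm (Fin m)) *
        rightFlagMinor (M.submatrix Fin.rev id) I := by
  have hm : n - m + m ≤ n := by
    have := labelSet_card_le n I
    omega
  rw [rightFlagMinor_eq_maximalMinor M hm ((card_labelSet_reflectLabels n I).trans hI),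
    rightFlagMinor_eq_maximalMinor _ hm hI, ← maximalMinor_submatrix_perm, labelSet_reflectLabels,
    ← maximalMinor_map_rev _ (labelSet n I)]
  congr 1
  ext i j
  simp only [submatrix_apply, id_eq, Fin.revPerm_apply, Fin.rev_rev]

theorem IsUpperUnitriangular.eq_of_rightFlagMinor_eq {A B : Matrix (Fin n) (Fin n) ℝ}
    (hA : IsUpperUnitriangular A) (hB : IsUpperUnitriangular B)
    (h : ∀ I, rightFlagMinor A I = rightFlagMinor B I) : A = B := by
  ext i j
  obtain hij | hij := lt_or_ge j i
  · rw [hA.1 _ _ hij, hB.1 _ _ hij]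
  · have entry : ∀ {C : Matrix (Fin n) (Fin n) ℝ}, IsUpperUnitriangular C →
        rightFlagMinor C (insert ((i : ℕ) + 1) (Icc ((j : ℕ) + 2) n)) = C i j := by
      intro C hC
      rw [hC.rightFlagMinor_eq_det (k := 1) (f := fun _ ↦ i) (s := j) (by omega)
        (Subsingleton.strictMono _) (fun _ ↦ Nat.lt_succ_of_le hij), det_fin_one]
      · rfl
      · intro x
        simp only [mem_insert, mem_Icc, Fin.ext_iff, exists_const]
        omega
    rw [← entry hA, ← entry hB, h]

end FlagMinors

/-- The factorization `P M P = A P D B` with `D = diagonal d` and factors `A`, `B` in `N_n` that are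
not required to be totally positive. -/
structure IsGaussDecomposition {n : ℕ} (M A B : Matrix (Fin n) (Fin n) ℝ) (d : Fin n → ℝ) :
    Prop where
  left : IsUpperUnitriangular A
  right : IsUpperUnitriangular B
  eq : antidiagonalMatrix n * M * antidiagonalMatrix n =
    A * antidiagonalMatrix n * diagonal d * B

theorem IsGaussTriple.isGaussDecomposition {n : ℕ} {M A B : Matrix (Fin n) (Fin n) ℝ}
    {d : Fin n → ℝ} (h : IsGaussTriple M A B d) : IsGaussDecomposition M A B d :=
  ⟨h.1.1, h.2.1.1, h.2.2⟩

theorem gauss_eq_iff {n : ℕ} {M A B : Matrix (Fin n) (Fin n) ℝ} {d : Fin n → ℝ} :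
    antidiagonalMatrix n * M * antidiagonalMatrix n =
        A * antidiagonalMatrix n * diagonal d * B ↔
      M.submatrix Fin.rev id = A * (diagonal d * B).submatrix Fin.rev Fin.rev := by
  have hL : antidiagonalMatrix n * (diagonal d * B) * antidiagonalMatrix n =
      (diagonal d * B).submatrix Fin.rev Fin.rev := by
    rw [antidiagonalMatrix_mul, mul_antidiagonalMatrix]
    rfl
  have hunit : IsUnit (antidiagonalMatrix n) := .of_mul_eq_one _ (antidiagonalMatrix_mul_self n)
  rw [← antidiagonalMatrix_mul, ← hL, ← hunit.mul_left_inj (b := antidiagonalMatrix n * M)]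
  simp only [Matrix.mul_assoc, antidiagonalMatrix_mul_self, Matrix.mul_one]

namespace IsGaussDecomposition

variable {n : ℕ} {M A B A' B' : Matrix (Fin n) (Fin n) ℝ} {d d' : Fin n → ℝ}

theorem rightFlagMinor_mul (h : IsGaussDecomposition M A B d) (I : Finset ℕ) :
    rightFlagMinor A I * rightFlagMinor M (Icc 1 #(labelSet n I)) =
      rightFlagMinor M (reflectLabels n I) := by
  set m := #(labelSet n I) with hI
  have hm : n - m + m ≤ n := (Nat.sub_add_cancel (labelSet_card_le n I)).le
  have hL : ((diagonal d * B).submatrix Fin.rev Fin.rev).IsLowerTriangular := by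
    intro i j (hij : i < j)
    rw [submatrix_apply, diagonal_mul, h.right.1 _ _ (Fin.rev_lt_rev.2 hij), mul_zero]
  have hreflect : reflectLabels n (Icc (n - m + 1) n) = Icc 1 m := by
    ext x
    simp only [reflectLabels, mem_filter, mem_Icc]
    omega
  rw [← hreflect, rightFlagMinor_reflectLabels M (card_labelSet_Icc hm),
    rightFlagMinor_reflectLabels M hI.symm, gauss_eq_iff.1 h.eq,
    rightFlagMinor_mul_of_isLowerTriangular A hL hm (card_labelSet_Icc hm),
    rightFlagMinor_mul_of_isLowerTriangular A hL hm hI.symm, h.left.rightFlagMinor_Icc hm]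
  ring

theorem antitranspose (h : IsGaussDecomposition M A B d) :
    IsGaussDecomposition (antitranspose M) (antitranspose B) (antitranspose A) d := by
  refine ⟨h.right.antitranspose, h.left.antitranspose, ?_⟩
  have cancel (X : Matrix (Fin n) (Fin n) ℝ) :
      antidiagonalMatrix n * (antidiagonalMatrix n * X) = X := by
    rw [← Matrix.mul_assoc, antidiagonalMatrix_mul_self, Matrix.one_mul]
  have htranspose := congrArg transpose h.eq
  simp only [transpose_mul, antidiagonalMatrix_transpose, diagonal_transpose,
    Matrix.mul_assoc] at htranspose
  simp only [antitranspose_eq, Matrix.mul_assoc, antidiagonalMatrix_mul_self, cancel,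
    Matrix.mul_one]
  have hconj := congrArg (fun X ↦ antidiagonalMatrix n * X * antidiagonalMatrix n) htranspose
  simpa only [Matrix.mul_assoc, antidiagonalMatrix_mul_self, cancel, Matrix.mul_one] using hconj

theorem left_pos (hM : IsTotallyPositiveUnitriangular M) (h : IsGaussDecomposition M A B d) :
    IsTotallyPositiveUnitriangular A := by
  refine h.left.isTotallyPositiveUnitriangular fun I ↦ ?_
  have hmul := h.rightFlagMinor_mul I
  exact pos_of_mul_pos_left (hmul ▸ hM.rightFlagMinor_pos _) (hM.rightFlagMinor_pos _).le

theorem isGaussTriple (hM : IsTotallyPositiveUnitriangular M)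
    (h : IsGaussDecomposition M A B d) : IsGaussTriple M A B d := by
  refine ⟨h.left_pos hM, ?_, h.eq⟩
  rw [← antitranspose_antitranspose B]
  exact (h.antitranspose.left_pos hM.antitranspose).antitranspose

theorem left_unique (hM : IsTotallyPositiveUnitriangular M) (h : IsGaussDecomposition M A B d)
    (h' : IsGaussDecomposition M A' B' d') : A = A' :=
  h.left.eq_of_rightFlagMinor_eq h'.left fun I ↦
    mul_right_cancel₀ (hM.rightFlagMinor_pos _).ne'
      ((h.rightFlagMinor_mul I).trans (h'.rightFlagMinor_mul I).symm)

theorem unique (hM : IsTotallyPositiveUnitriangular M) (h : IsGaussDecomposition M A B d)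
    (h' : IsGaussDecomposition M A' B' d') : A = A' ∧ B = B' ∧ d = d' := by
  obtain rfl := h.left_unique hM h'
  obtain rfl : B = B' := by
    rw [← antitranspose_antitranspose B, h.antitranspose.left_unique hM.antitranspose
      h'.antitranspose, antitranspose_antitranspose]
  have isUnit {C : Matrix (Fin n) (Fin n) ℝ} (hC : IsUpperUnitriangular C) : IsUnit C := by
    have hdet : C.det = 1 := hC.det_submatrix_self strictMono_id
    rw [isUnit_iff_isUnit_det, hdet]
    exact isUnit_one
  have hP : IsUnit (antidiagonalMatrix n) := .of_mul_eq_one _ (antidiagonalMatrix_mul_self n)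
  exact ⟨rfl, rfl, diagonal_injective (((isUnit h.left).mul hP).mul_left_cancel
    ((isUnit h.right).mul_right_cancel (h.eq.symm.trans h'.eq)))⟩

end IsGaussDecomposition

section Existence

variable {n : ℕ} {M : Matrix (Fin n) (Fin n) ℝ}

theorem IsTotallyPositiveUnitriangular.det_submatrix_rev_ne_zero
    (hM : IsTotallyPositiveUnitriangular M) (j : Fin n) :
    ((M.submatrix Fin.rev id).submatrix ((↑) : {i // j ≤ i} → Fin n) (↑)).det ≠ 0 := by
  obtain ⟨m, hmn, hm⟩ : ∃ m, n - m + m ≤ n ∧ n - m = (j : ℕ) := ⟨n - j, by omega, by omega⟩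
  let f (i : Fin m) : {i // j ≤ i} :=
    ⟨consecutive (n - m) hmn i, Fin.le_def.2 (hm.symm.le.trans (Nat.le_add_right _ _))⟩
  have hf : Function.Bijective f := by
    refine ⟨fun a b hab ↦ (strictMono_consecutive hmn).injective (congrArg Subtype.val hab), ?_⟩
    rintro ⟨i, hi⟩
    obtain ⟨a, ha⟩ := (exists_consecutive_eq_iff hmn (x := i)).2
      (by rw [Fin.le_def] at hi; omega)
    exact ⟨a, Subtype.ext ha⟩
  have hpos := hM.rightFlagMinor_pos (reflectLabels n (Icc (n - m + 1) n))
  rw [rightFlagMinor_reflectLabels M (card_labelSet_Icc hmn),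
    rightFlagMinor_of_labelSet_eq_image _ hmn (strictMono_consecutive hmn)
      (labelSet_Icc hmn)] at hpos
  rw [← det_submatrix_equiv_self (Equiv.ofBijective f hf)]
  exact right_ne_zero_of_mul hpos.ne'

theorem IsTotallyPositiveUnitriangular.exists_isGaussTriple
    (hM : IsTotallyPositiveUnitriangular M) : ∃ A B d, IsGaussTriple M A B d := by
  obtain ⟨A, L, hA, hdiag, hL, hne, hX⟩ := exists_eq_upper_mul_lower hM.det_submatrix_rev_ne_zero
  let B : Matrix (Fin n) (Fin n) ℝ := .of fun i j ↦ (L i.rev i.rev)⁻¹ * L i.rev j.rev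
  have hB : IsUpperUnitriangular B := by
    refine ⟨fun i j hij ↦ ?_, fun i ↦ inv_mul_cancel₀ (hne i.rev)⟩
    have hzero : L i.rev j.rev = 0 := hL (Fin.rev_lt_rev.2 hij)
    exact (congrArg _ hzero).trans (mul_zero _)
  have hfactor : (diagonal (fun i : Fin n ↦ L i.rev i.rev) * B).submatrix Fin.rev Fin.rev = L := by
    ext i j
    simp only [B, submatrix_apply, diagonal_mul, of_apply, Fin.rev_rev]
    exact mul_inv_cancel_left₀ (hne i) _
  refine ⟨A, B, fun i ↦ L i.rev i.rev, IsGaussDecomposition.isGaussTriple hM ⟨⟨?_, hdiag⟩, hB, ?_⟩⟩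
  · exact fun i j hij ↦ hA hij
  · rw [gauss_eq_iff, hX, hfactor]

end Existence

/-! ### The functions `Y` and `Ỹ` -/

theorem reflectLabels_insert {n a : ℕ} (ha : a ∈ Icc 1 n) (X : Finset ℕ) :
    reflectLabels n (insert a X) = insert (n + 1 - a) (reflectLabels n X) := by
  rw [mem_Icc] at ha
  ext x
  simp only [reflectLabels, mem_insert, mem_filter, mem_Icc, and_or_left]
  exact or_congr_left (by omega)

theorem exchangeRatio_reflectLabels {n : ℕ} (f : Finset ℕ → ℝ) (X : Finset ℕ) {a b c : ℕ}
    (ha : a ∈ Icc 1 n) (hb : b ∈ Icc 1 n) (hc : c ∈ Icc 1 n) :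
    exchangeRatio (fun I ↦ f (reflectLabels n I)) X a b c =
      1 / exchangeRatio f (reflectLabels n X) (n + 1 - c) (n + 1 - b) (n + 1 - a) := by
  simp only [exchangeRatio, reflectLabels_insert, ha, hb, hc, one_div_div,
    insert_comm (n + 1 - c), insert_comm (n + 1 - b) (n + 1 - a)]
  ring

section

variable {n a b c : ℕ} {M A B : Matrix (Fin n) (Fin n) ℝ} {d : Fin n → ℝ}

theorem reflectLabels_exchangeContext_zero (hab : a < b) (hbc : b < c) (hc : c ≤ n) :
    reflectLabels n (exchangeContext n 0 a b c) =
      exchangeContext n n (n + 1 - c) (n + 1 - b) (n + 1 - a) := by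
  ext x
  simp only [reflectLabels, exchangeContext, mem_filter, mem_Icc]
  omega

theorem reflectLabels_exchangeContext_self (hab : a < b) (hbc : b < c) (hc : c ≤ n) :
    reflectLabels n (exchangeContext n n a b c) =
      exchangeContext n 0 (n + 1 - c) (n + 1 - b) (n + 1 - a) := by
  ext x
  simp only [reflectLabels, exchangeContext, mem_filter, mem_Icc]
  omega

theorem lowerY_eq_exchangeRatio (M : Matrix (Fin n) (Fin n) ℝ) (ha : 1 ≤ a) (hab : a < b)
    (hbc : b < c) (hc : c ≤ n) :
    lowerY M a b c = exchangeRatio (rightFlagMinor M) (exchangeContext n 0 a b c) a b c := by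
  unfold lowerY exchangeRatio
  congr 2 <;> congr 1 <;> ext x <;>
    simp only [exchangeContext, mem_insert, mem_filter, mem_union, mem_Icc] <;> omega

theorem lowerYTilde_eq_exchangeRatio (M : Matrix (Fin n) (Fin n) ℝ) (ha : 1 ≤ a) (hab : a < b)
    (hbc : b < c) (hc : c ≤ n) :
    lowerYTilde M a b c = exchangeRatio (rightFlagMinor M) (exchangeContext n n a b c) a b c := by
  unfold lowerYTilde exchangeRatio
  congr 2 <;> congr 1 <;> ext x <;>
    simp only [exchangeContext, mem_insert, mem_filter, mem_union, mem_Icc] <;> omega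

theorem upperY_eq_lowerYTilde_antitranspose (M : Matrix (Fin n) (Fin n) ℝ) (ha : 1 ≤ a)
    (hab : a < b) (hbc : b < c) (hc : c ≤ n) :
    upperY M a b c = lowerYTilde (antitranspose M) (n + 1 - c) (n + 1 - b) (n + 1 - a) := by
  simp only [upperY, lowerYTilde, upperFlagMinor_eq_rightFlagMinor_antitranspose]
  congr 1 <;> rw [mul_comm] <;> congr 2 <;> ext x <;>
    simp only [reflectLabels, mem_filter, mem_union, mem_Icc] <;> omega

theorem upperYTilde_eq_lowerY_antitranspose (M : Matrix (Fin n) (Fin n) ℝ) (ha : 1 ≤ a)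
    (hab : a < b) (hbc : b < c) (hc : c ≤ n) :
    upperYTilde M a b c = lowerY (antitranspose M) (n + 1 - c) (n + 1 - b) (n + 1 - a) := by
  simp only [upperYTilde, lowerY, upperFlagMinor_eq_rightFlagMinor_antitranspose]
  congr 1 <;> rw [mul_comm] <;> congr 2 <;> ext x <;>
    simp only [reflectLabels, mem_filter, mem_union, mem_Icc] <;> omega

theorem IsUpperUnitriangular.lowerY_eq_upperYTilde (hM : IsUpperUnitriangular M) (ha : 1 ≤ a)
    (hab : a < b) (hbc : b < c) (hc : c ≤ n) :
    lowerY M a b c = upperYTilde M a (a + c - b) c := by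
  unfold lowerY upperYTilde
  rw [mul_comm (upperFlagMinor M _),
    mul_comm (upperFlagMinor M (Icc 1 a ∪ Icc (a + c - b + 1) (c - 1)))]
  congr 2
  · refine hM.rightFlagMinor_eq_upperFlagMinor (a := a) (k := b - a) (c := c) ha (by omega) hc
      ?_ ?_ <;> intro x <;> simp only [mem_union, mem_Icc] <;> omega
  · refine hM.rightFlagMinor_eq_upperFlagMinor (a := a + 1) (k := b - a) (c := c - 1) (by omega)
      (by omega) (by omega) ?_ ?_ <;> intro x <;> simp only [mem_union, mem_Icc] <;> omega
  · refine hM.rightFlagMinor_eq_upperFlagMinor (a := a) (k := b - a + 1) (c := c) ha (by omega) hc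
      ?_ ?_ <;> intro x <;> simp only [mem_union, mem_Icc] <;> omega
  · refine hM.rightFlagMinor_eq_upperFlagMinor (a := a + 1) (k := b - a - 1) (c := c - 1)
      (by omega) (by omega) (by omega) ?_ ?_ <;> intro x <;> simp only [mem_union, mem_Icc] <;>
      omega

theorem IsGaussDecomposition.exchangeRatio_eq (hM : IsTotallyPositiveUnitriangular M)
    (h : IsGaussDecomposition M A B d) {X : Finset ℕ} (ha : a ∈ Icc 1 n) (hb : b ∈ Icc 1 n)
    (hc : c ∈ Icc 1 n) (hab : a < b) (hbc : b < c) (haX : a ∉ X) (hbX : b ∉ X) (hcX : c ∉ X) :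
    exchangeRatio (rightFlagMinor A) X a b c =
      1 / exchangeRatio (rightFlagMinor M) (reflectLabels n X)
        (n + 1 - c) (n + 1 - b) (n + 1 - a) := by
  have card_insert {x : ℕ} {S : Finset ℕ} (hx : x ∈ Icc 1 n) (hxS : x ∉ S) :
      #(labelSet n (insert x S)) = #(labelSet n S) + 1 := by
    rw [mem_Icc] at hx
    obtain ⟨x, rfl⟩ := exists_val_add_one_eq hx.1 hx.2
    rw [labelSet_insert, card_insert_of_notMem (mem_labelSet.not.2 hxS)]
  have hbcX : b ∉ insert c X := by simp only [mem_insert, hbc.ne, hbX, or_self, not_false_eq_true]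
  have habX : a ∉ insert b X := by simp only [mem_insert, hab.ne, haX, or_self, not_false_eq_true]
  rw [← exchangeRatio_reflectLabels _ _ ha hb hc]
  simp only [exchangeRatio, ← h.rightFlagMinor_mul, card_insert hb hbcX, card_insert ha habX,
    card_insert ha haX, card_insert hb hbX, card_insert hc hcX]
  have pos (m : ℕ) := hM.rightFlagMinor_pos (Icc 1 m)
  rw [mul_mul_mul_comm, mul_mul_mul_comm (rightFlagMinor A (insert a (insert b X))),
    mul_comm (rightFlagMinor M (Icc 1 (#(labelSet n X) + 1 + 1))),
    mul_div_mul_right _ _ (mul_pos (pos _) (pos _)).ne']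

theorem IsGaussDecomposition.lowerY_eq (hM : IsTotallyPositiveUnitriangular M)
    (h : IsGaussDecomposition M A B d) (ha : 1 ≤ a) (hab : a < b) (hbc : b < c) (hc : c ≤ n) :
    lowerY A a b c = 1 / lowerYTilde M (n + 1 - c) (n + 1 - b) (n + 1 - a) := by
  rw [lowerY_eq_exchangeRatio _ ha hab hbc hc,
    lowerYTilde_eq_exchangeRatio _ (by omega) (by omega) (by omega) (by omega),
    ← reflectLabels_exchangeContext_zero hab hbc hc]
  refine h.exchangeRatio_eq hM ?_ ?_ ?_ hab hbc ?_ ?_ ?_ <;>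
    simp only [exchangeContext, mem_Icc, mem_filter] <;> omega

theorem IsGaussDecomposition.lowerYTilde_eq (hM : IsTotallyPositiveUnitriangular M)
    (h : IsGaussDecomposition M A B d) (ha : 1 ≤ a) (hab : a < b) (hbc : b < c) (hc : c ≤ n) :
    lowerYTilde A a b c = 1 / lowerY M (n + 1 - c) (n + 1 - b) (n + 1 - a) := by
  rw [lowerYTilde_eq_exchangeRatio _ ha hab hbc hc,
    lowerY_eq_exchangeRatio _ (by omega) (by omega) (by omega) (by omega),
    ← reflectLabels_exchangeContext_self hab hbc hc]
  refine h.exchangeRatio_eq hM ?_ ?_ ?_ hab hbc ?_ ?_ ?_ <;>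
    simp only [exchangeContext, mem_Icc, mem_filter] <;> omega

end

/-! ### Sums over the tetrahedron -/

theorem dilogSum_congr {n : ℕ} {Y Z : ℕ → ℕ → ℕ → ℝ}
    (h : ∀ a b c, 1 ≤ a → a < b → b < c → c ≤ n → Y a b c = Z a b c) :
    dilogSum n Y = dilogSum n Z := by
  refine sum_congr rfl fun t ht ↦ ?_
  obtain ⟨ha, hab, hbc, hc⟩ := mem_tetrahedron.1 ht
  rw [h _ _ _ ha hab hbc hc]

theorem dilogSum_reflect (n : ℕ) (Y : ℕ → ℕ → ℕ → ℝ) :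
    dilogSum n (fun a b c ↦ Y (n + 1 - c) (n + 1 - b) (n + 1 - a)) = dilogSum n Y := by
  let reflect (t : ℕ × ℕ × ℕ) : ℕ × ℕ × ℕ := (n + 1 - t.2.2, n + 1 - t.2.1, n + 1 - t.1)
  have reflect_mem : ∀ t ∈ tetrahedron n, reflect t ∈ tetrahedron n := by
    simp only [reflect, mem_tetrahedron, Prod.forall]
    omega
  have reflect_reflect : ∀ t ∈ tetrahedron n, reflect (reflect t) = t := by
    simp only [reflect, mem_tetrahedron, Prod.forall, Prod.mk.injEq]
    omega
  exact sum_nbij' reflect reflect reflect_mem reflect_mem reflect_reflect reflect_reflect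
    fun _ _ ↦ rfl

theorem dilogSum_shear (n : ℕ) (Y : ℕ → ℕ → ℕ → ℝ) :
    dilogSum n (fun a b c ↦ Y a (a + c - b) c) = dilogSum n Y := by
  let shear (t : ℕ × ℕ × ℕ) : ℕ × ℕ × ℕ := (t.1, t.1 + t.2.2 - t.2.1, t.2.2)
  have shear_mem : ∀ t ∈ tetrahedron n, shear t ∈ tetrahedron n := by
    simp only [shear, mem_tetrahedron, Prod.forall]
    omega
  have shear_shear : ∀ t ∈ tetrahedron n, shear (shear t) = t := by
    simp only [shear, mem_tetrahedron, Prod.forall, Prod.mk.injEq, true_and, and_true]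
    omega
  exact sum_nbij' shear shear shear_mem shear_mem shear_shear shear_shear fun _ _ ↦ rfl

section

variable {n : ℕ} {M A B : Matrix (Fin n) (Fin n) ℝ} {d : Fin n → ℝ}

theorem dilogSum_comp_upperY (M : Matrix (Fin n) (Fin n) ℝ) (φ : ℝ → ℝ) :
    dilogSum n (fun a b c ↦ φ (upperY M a b c)) =
      dilogSum n fun a b c ↦ φ (lowerYTilde (antitranspose M) a b c) := by
  rw [← dilogSum_reflect n fun a b c ↦ φ (lowerYTilde (antitranspose M) a b c)]
  exact dilogSum_congr fun a b c ha hab hbc hc ↦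
    congrArg φ (upperY_eq_lowerYTilde_antitranspose M ha hab hbc hc)

theorem dilogSum_comp_upperYTilde (M : Matrix (Fin n) (Fin n) ℝ) (φ : ℝ → ℝ) :
    dilogSum n (fun a b c ↦ φ (upperYTilde M a b c)) =
      dilogSum n fun a b c ↦ φ (lowerY (antitranspose M) a b c) := by
  rw [← dilogSum_reflect n fun a b c ↦ φ (lowerY (antitranspose M) a b c)]
  exact dilogSum_congr fun a b c ha hab hbc hc ↦
    congrArg φ (upperYTilde_eq_lowerY_antitranspose M ha hab hbc hc)

theorem IsUpperUnitriangular.dilogSum_comp_upperYTilde (hM : IsUpperUnitriangular M)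
    (φ : ℝ → ℝ) :
    dilogSum n (fun a b c ↦ φ (upperYTilde M a b c)) =
      dilogSum n fun a b c ↦ φ (lowerY M a b c) := by
  rw [← dilogSum_shear n fun a b c ↦ φ (upperYTilde M a b c)]
  exact dilogSum_congr fun a b c ha hab hbc hc ↦
    congrArg φ (hM.lowerY_eq_upperYTilde ha hab hbc hc).symm

theorem IsUpperUnitriangular.dilogSum_comp_lowerY_antitranspose (hM : IsUpperUnitriangular M)
    (φ : ℝ → ℝ) :
    dilogSum n (fun a b c ↦ φ (lowerY (_root_.antitranspose M) a b c)) =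
      dilogSum n fun a b c ↦ φ (lowerY M a b c) :=
  (_root_.dilogSum_comp_upperYTilde M φ).symm.trans (hM.dilogSum_comp_upperYTilde φ)

namespace IsTotallyPositiveUnitriangular

theorem dilogSum_lowerYTilde (hM : IsTotallyPositiveUnitriangular M) :
    dilogSum n (lowerYTilde M) = dilogSum n (lowerY M) := by
  rw [dilogSum_congr fun _ _ _ ↦ lowerYTilde_eq_exchangeRatio M,
    ← hM.isPositiveFlag.dilogSum_exchangeRatio]
  exact (dilogSum_congr fun _ _ _ ↦ lowerY_eq_exchangeRatio M).symm

theorem dilogSum_upperYTilde (hM : IsTotallyPositiveUnitriangular M) :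
    dilogSum n (upperYTilde M) = dilogSum n (lowerY M) :=
  hM.1.dilogSum_comp_upperYTilde id

theorem dilogSum_upperY (hM : IsTotallyPositiveUnitriangular M) :
    dilogSum n (upperY M) = dilogSum n (lowerY M) :=
  calc dilogSum n (upperY M)
    _ = dilogSum n (lowerYTilde (_root_.antitranspose M)) := dilogSum_comp_upperY M id
    _ = dilogSum n (lowerY (_root_.antitranspose M)) := hM.antitranspose.dilogSum_lowerYTilde
    _ = dilogSum n (lowerY M) := hM.1.dilogSum_comp_lowerY_antitranspose id

end IsTotallyPositiveUnitriangular

namespace IsGaussDecomposition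

theorem dilogSum_one_div_lowerY (hM : IsTotallyPositiveUnitriangular M)
    (h : IsGaussDecomposition M A B d) :
    dilogSum n (fun a b c ↦ 1 / lowerY M a b c) = dilogSum n (lowerY A) := by
  rw [← (h.left_pos hM).dilogSum_lowerYTilde, ← dilogSum_reflect n fun a b c ↦ 1 / lowerY M a b c]
  exact (dilogSum_congr fun _ _ _ ↦ h.lowerYTilde_eq hM).symm

theorem dilogSum_one_div_lowerYTilde (hM : IsTotallyPositiveUnitriangular M)
    (h : IsGaussDecomposition M A B d) :
    dilogSum n (fun a b c ↦ 1 / lowerYTilde M a b c) = dilogSum n (lowerY A) := by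
  rw [← dilogSum_reflect n fun a b c ↦ 1 / lowerYTilde M a b c]
  exact (dilogSum_congr fun _ _ _ ↦ h.lowerY_eq hM).symm

theorem dilogSum_one_div_upperYTilde (hM : IsTotallyPositiveUnitriangular M)
    (h : IsGaussDecomposition M A B d) :
    dilogSum n (fun a b c ↦ 1 / upperYTilde M a b c) = dilogSum n (lowerY A) :=
  (hM.1.dilogSum_comp_upperYTilde (1 / ·)).trans (h.dilogSum_one_div_lowerY hM)

theorem dilogSum_lowerY_right (hM : IsTotallyPositiveUnitriangular M)
    (h : IsGaussDecomposition M A B d) :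
    dilogSum n (lowerY B) = dilogSum n (lowerY A) :=
  calc dilogSum n (lowerY B)
    _ = dilogSum n (lowerY (_root_.antitranspose B)) :=
      (h.right.dilogSum_comp_lowerY_antitranspose id).symm
    _ = dilogSum n fun a b c ↦ 1 / lowerY (_root_.antitranspose M) a b c :=
      (h.antitranspose.dilogSum_one_div_lowerY hM.antitranspose).symm
    _ = dilogSum n fun a b c ↦ 1 / lowerY M a b c :=
      hM.1.dilogSum_comp_lowerY_antitranspose (1 / ·)
    _ = dilogSum n (lowerY A) := h.dilogSum_one_div_lowerY hM

theorem dilogSum_one_div_upperY (hM : IsTotallyPositiveUnitriangular M)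
    (h : IsGaussDecomposition M A B d) :
    dilogSum n (fun a b c ↦ 1 / upperY M a b c) = dilogSum n (lowerY A) :=
  calc dilogSum n (fun a b c ↦ 1 / upperY M a b c)
    _ = dilogSum n fun a b c ↦ 1 / lowerYTilde (_root_.antitranspose M) a b c :=
      dilogSum_comp_upperY M (1 / ·)
    _ = dilogSum n (lowerY (_root_.antitranspose B)) :=
      h.antitranspose.dilogSum_one_div_lowerYTilde hM.antitranspose
    _ = dilogSum n (lowerY B) := h.right.dilogSum_comp_lowerY_antitranspose id
    _ = dilogSum n (lowerY A) := h.dilogSum_lowerY_right hM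

end IsGaussDecomposition

end

theorem theorem3p1 (n : ℕ) (M : Matrix (Fin n) (Fin n) ℝ)
    (hM : IsTotallyPositiveUnitriangular M) :
    ∃ (M' M'' : Matrix (Fin n) (Fin n) ℝ) (d : Fin n → ℝ),
      IsGaussTriple M M' M'' d ∧
      (∀ (A B : Matrix (Fin n) (Fin n) ℝ) (e : Fin n → ℝ),
        IsGaussTriple M A B e → A = M' ∧ B = M'' ∧ e = d) ∧
      -- the chain of twelve equal sums, link by link
      dilogSum n (fun a b c => lowerY M' a b c) =
        dilogSum n (fun a b c => 1 / lowerY M a b c) ∧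
      dilogSum n (fun a b c => 1 / lowerY M a b c) =
        dilogSum n (fun a b c => lowerY M'' a b c) ∧
      dilogSum n (fun a b c => lowerY M'' a b c) =
        dilogSum n (fun a b c => upperYTilde M' a b c) ∧
      dilogSum n (fun a b c => upperYTilde M' a b c) =
        dilogSum n (fun a b c => 1 / upperYTilde M a b c) ∧
      dilogSum n (fun a b c => 1 / upperYTilde M a b c) =
        dilogSum n (fun a b c => upperYTilde M'' a b c) ∧
      dilogSum n (fun a b c => upperYTilde M'' a b c) =
        dilogSum n (fun a b c => lowerYTilde M' a b c) ∧
      dilogSum n (fun a b c => lowerYTilde M' a b c) =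
        dilogSum n (fun a b c => 1 / lowerYTilde M a b c) ∧
      dilogSum n (fun a b c => 1 / lowerYTilde M a b c) =
        dilogSum n (fun a b c => lowerYTilde M'' a b c) ∧
      dilogSum n (fun a b c => lowerYTilde M'' a b c) =
        dilogSum n (fun a b c => upperY M' a b c) ∧
      dilogSum n (fun a b c => upperY M' a b c) =
        dilogSum n (fun a b c => 1 / upperY M a b c) ∧
      dilogSum n (fun a b c => 1 / upperY M a b c) =
        dilogSum n (fun a b c => upperY M'' a b c) := by
  obtain ⟨A, B, d, h⟩ := hM.exists_isGaussTriple
  have hG := h.isGaussDecomposition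
  refine ⟨A, B, d, h, fun A' B' e h' ↦ h'.isGaussDecomposition.unique hM hG, ?_⟩
  simp only [h.1.dilogSum_lowerYTilde, h.1.dilogSum_upperY, h.1.dilogSum_upperYTilde,
    h.2.1.dilogSum_lowerYTilde, h.2.1.dilogSum_upperY, h.2.1.dilogSum_upperYTilde,
    hG.dilogSum_one_div_lowerY hM, hG.dilogSum_one_div_lowerYTilde hM,
    hG.dilogSum_one_div_upperY hM, hG.dilogSum_one_div_upperYTilde hM,
    hG.dilogSum_lowerY_right hM, and_self]
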